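/- Let $q$ be an indeterminate, $n\ge 1$, $\xi=-q^{-2n}$, $i'=2n-i+1$ for $1\le i\le 2n$, and $(\bar 1,\dots,\overline{2n})=(n-1,\dots,1,0,0,-1,\dots,-n+1)$. Let $e_{ij}\in\operatorname{End}\mathbb C^{2n}$ be the matrix units and put $$\begin{aligned}\overline R^{[n]}(x)={}&\sum_{i}e_{ii}\otimes e_{ii}+\frac{x-1}{qx-q^{-1}}\sum_{i\ne j,j'}e_{ii}\otimes e_{jj}+\frac{q-q^{-1}}{qx-q^{-1}}\sum_{i>j,\,i\ne j'}e_{ij}\otimes e_{ji}\\&+\frac{(q-q^{-1})x}{qx-q^{-1}}\sum_{i<j,\,i\ne j'}e_{ij}\otimes e_{ji}+\frac1{(x-q^{-2})(x-\xi)}\sum_{i,j}a_{ij}(x)\,e_{i'j'}\otimes e_{ij},\end{aligned}$$ where $a_{ii}(x)=(q^{-2}x-\xi)(x-1)$, $a_{ij}(x)=(q^{-2}-1)\big(q^{\bar i-\bar j}\xi(x-1)-\delta_{ij'}(x-\xi)\big)$ for $i<j$, and $a_{ij}(x)=(q^{-2}-1)x\big(q^{\bar i-\bar j}(x-1)-\delta_{ij'}(x-\xi)\big)$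 for $i>j$. Let $R^{[n]}(x)=f(x)\overline R^{[n]}(x)$, where $$f(x)=\xi q^{-2}\prod_{r\ge 0}\frac{(1-x\xi^{2r})(1-xq^{-2}\xi^{2r+1})(1-xq^{2}\xi^{2r+1})(1-x\xi^{2r+2})}{(1-x\xi^{2r+1})^2(1-xq^{2}\xi^{2r+2})(1-xq^{-2}\xi^{2r})}.$$ All these functions of $x$ are regarded as formal power series in $x$ over $\mathbb C(q)$. For $S\in\{\overline R^{[n]},R^{[n]}\}$ let $U(S)$ be the unital associative $\mathbb C(q)$-algebra generated by an invertible central element $q^{c/2}$ and elements $l^{\pm}_{ij}[\mp m]$ ($1\le i,j\le 2n$, $m\ge 0$), subject to $l^+_{ij}[0]=l^-_{ji}[0]=0$ for $i<j$, $l^+_{nn}[0]\,l^+_{n+1,n+1}[0]=1$, $l^+_{ii}[0]\,l^-_{ii}[0]=l^-_{ii}[0]\,l^+_{ii}[0]=1$, and $$S(u/v)L^\pm_1(u)L^\pm_2(v)=L^\pm_2(v)L^\pm_1(u)S(u/v),\qquad S(uq^c/v)L^+_1(u)L^-_2(v)=L^-_2(v)L^+_1(u)S(uq^{-c}/v),$$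 where $l^\pm_{ij}(u)=\sum_{m\ge0}l^\pm_{ij}[\mp m]u^{\pm m}$ and $L^\pm(u)=(l^\pm_{ij}(u))$. Then, in $U(\overline R^{[n]})$ and in $U(R^{[n]})$, and for each of the two signs: * $L^\pm(u)$ has a unique Gauss decomposition $L^\pm(u)=F^\pm(u)H^\pm(u)E^\pm(u)$ with $F^\pm(u)$ lower unitriangular, $E^\pm(u)$ upper unitriangular and $H^\pm(u)=\operatorname{diag}[h^\pm_1(u),\dots,h^\pm_{2n}(u)]$ (all entries being power series in $u^{\pm1}$), and all $h_i^\pm(u)$ are invertible; * there is a unique series $z^{[n]\pm}(u)$ in $u^{\pm1}$ with coefficients in the algebra such that $D L^\pm(u\xi)^{t}D^{-1}L^\pm(u)=L^\pm(u)D L^\pm(u\xi)^{t}D^{-1}=z^{[n]\pm}(u)\cdot 1$, where $D=\operatorname{diag}(q^{\bar 1},\dots,q^{\overline{2n}})$ and $e_{ij}^t=e_{j'i'}$ (this series is denoted $\mathfrak z^{[n]\pm}(u)$ in the case of $U(\overline R^{[n]})$); * one has $$z^{[n]\pm}(u)=\prod_{i=1}^{n-1}h^\pm_i(u\xi q^{2i})^{-1}\;\prod_{i=1}^{n}h^\pm_i(u\xi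 q^{2i-2})\;h^\pm_{n+1}(u),$$ the factors being multiplied in the order in which they are written. -/

import Mathlib

noncomputable section

namespace QAff

open PowerSeries

/-- The ground field `ℂ(q)` of rational functions. -/
abbrev K : Type := RatFunc ℂ

/-- The indeterminate `q`. -/
abbrev q : K := RatFunc.X

/-- `ξ = -q^{-2n}`. -/
def xi (n : ℕ) : K := -q ^ (-2 * (n : ℤ))

/-- `(1̄, …, 2n̄) = (n-1, …, 1, 0, 0, -1, …, -n+1)`; indices are 0-based. -/
def bar {n : ℕ} (i : Fin (2 * n)) : ℤ :=
  if (i : ℕ) < n then (n : ℤ) - 1 - (i : ℕ) else (n : ℤ) - (i : ℕ)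

/-! The involution `i ↦ i' = 2n - i + 1` is `Fin.rev` in 0-based indexing.

Elements of `End V ⊗ End V`, `V = ℂ^{2n}`, with coefficients in a ring are matrices indexed by
pairs: the entry at `(a, b), (c, d)` is the coefficient of `e_{ac} ⊗ e_{bd}`. -/

/-- The polynomials `a_{ij}(x)` (as power series in `x`). -/
def aCoef (n : ℕ) (i j : Fin (2 * n)) : K⟦X⟧ :=
  if i = j then (C (q ^ (-2 : ℤ)) * X - C (xi n)) * (X - 1)
  else if i < j then
    C (q ^ (-2 : ℤ) - 1) * (C (q ^ (bar i - bar j) * xi n) * (X - 1)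
      - (if i = j.rev then X - C (xi n) else 0))
  else
    C (q ^ (-2 : ℤ) - 1) * X * (C (q ^ (bar i - bar j)) * (X - 1)
      - (if i = j.rev then X - C (xi n) else 0))

/-- The R-matrix `R̄(x)`; its entries are rational functions of `x` which are regular at `x = 0`,
and are regarded as formal power series in `x` over `ℂ(q)`. -/
def Rbar (n : ℕ) : Matrix (Fin (2 * n) × Fin (2 * n)) (Fin (2 * n) × Fin (2 * n)) K⟦X⟧ :=
  Matrix.of fun r s =>
    let a := r.1
    let b := r.2
    let c := s.1
    let d := s.2
    -- `∑ e_{ii} ⊗ e_{ii}`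
    (if c = a ∧ d = b ∧ a = b then 1 else 0)
    -- `(x - 1) / (q x - q⁻¹) ∑_{i ≠ j, j'} e_{ii} ⊗ e_{jj}`
    + (if c = a ∧ d = b ∧ a ≠ b ∧ a ≠ b.rev then
        (X - 1) * (C q * X - C q⁻¹)⁻¹ else 0)
    -- `(q - q⁻¹) / (q x - q⁻¹) ∑_{i > j, i ≠ j'} e_{ij} ⊗ e_{ji}`
    + (if c = b ∧ d = a ∧ b < a ∧ a ≠ b.rev then
        C (q - q⁻¹) * (C q * X - C q⁻¹)⁻¹ else 0)
    -- `(q - q⁻¹) x / (q x - q⁻¹) ∑_{i < j, i ≠ j'} e_{ij} ⊗ e_{ji}`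
    + (if c = b ∧ d = a ∧ a < b ∧ a ≠ b.rev then
        C (q - q⁻¹) * X * (C q * X - C q⁻¹)⁻¹ else 0)
    -- `1 / ((x - q⁻²) (x - ξ)) ∑ a_{ij}(x) e_{i'j'} ⊗ e_{ij}`
    + (if a = b.rev ∧ c = d.rev then
        aCoef n b d * ((X - C (q ^ (-2 : ℤ))) * (X - C (xi n)))⁻¹ else 0)

/-- The coefficients of the infinite product `∏_{r ≥ 0} (1 - p^r x)`. -/
def pochCoeff (p : K) : ℕ → K
  | 0 => 1
  | k + 1 => -(p ^ k / (1 - p ^ (k + 1))) * pochCoeff p k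

/-- The infinite product `(x; p)_∞ = ∏_{r ≥ 0} (1 - p^r x)` as a formal power series in `x`, for
`p` not a root of unity.  See `poch_eq` and `poch_eq_prod`. -/
def poch (p : K) : K⟦X⟧ := PowerSeries.mk (pochCoeff p)

/-- `(x; p)_∞` has constant term `1` and satisfies `(x; p)_∞ = (1 - x) (p x; p)_∞`. -/
theorem poch_eq (p : K) (hp : ∀ k : ℕ, p ^ (k + 1) ≠ 1) :
    constantCoeff (poch p) = 1 ∧ poch p = (1 - X) * rescale p (poch p) := by
  refine ⟨by
    rw [← coeff_zero_eq_constantCoeff_apply, poch, coeff_mk, pochCoeff], ?_⟩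
  ext k
  cases k with
  | zero =>
    rw [sub_mul, one_mul, map_sub, coeff_zero_X_mul, sub_zero, coeff_rescale, pow_zero, one_mul]
  | succ k =>
    have h : (1 : K) - p ^ (k + 1) ≠ 0 := sub_ne_zero.2 (hp k).symm
    simp only [poch, sub_mul, one_mul, map_sub, coeff_succ_X_mul, coeff_rescale, coeff_mk,
      pochCoeff]
    field_simp
    ring

/-- `(x; p)_∞ = ∏_{r < m} (1 - p^r x) · (p^m x; p)_∞`, where the coefficient of `x^k` in the last
factor carries `p^{m k}`, which tends to zero as `m → ∞`. -/
theorem poch_eq_prod (p : K) (hp : ∀ k : ℕ, p ^ (k + 1) ≠ 1) (m : ℕ) :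
    poch p = (∏ r ∈ Finset.range m, (1 - C (p ^ r) * X)) * rescale (p ^ m) (poch p) := by
  induction m with
  | zero => simp
  | succ m ih =>
    rw [Finset.prod_range_succ, mul_assoc]
    refine ih.trans ?_
    congr 1
    conv_lhs => rw [(poch_eq p hp).2]
    rw [map_mul, map_sub, map_one, rescale_X, rescale_rescale, pow_succ']

/-- `ξ²` is not a root of unity. -/
theorem xi_sq_pow_ne_one (n : ℕ) (hn : 1 ≤ n) (k : ℕ) : (xi n ^ 2) ^ (k + 1) ≠ 1 := by
  intro h
  have hq : (q : K) ^ (4 * n * (k + 1)) = 1 := by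
    have e : (xi n ^ 2) ^ (k + 1) = ((q : K) ^ (4 * n * (k + 1)))⁻¹ := by
      have e1 : xi n = -((q : K) ^ (2 * n))⁻¹ := by
        simp only [xi, neg_mul, zpow_neg]
        norm_cast
      rw [e1, neg_sq, inv_pow, inv_pow, ← pow_mul, ← pow_mul]
      congr 2
      ring
    rw [e] at h
    exact inv_eq_one.1 h
  have h2 : (Polynomial.X : Polynomial ℂ) ^ (4 * n * (k + 1)) = 1 := by
    apply RatFunc.algebraMap_injective ℂ
    rw [map_pow, map_one, RatFunc.algebraMap_X]
    exact hq
  have h3 := congrArg Polynomial.natDegree h2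
  rw [Polynomial.natDegree_X_pow, Polynomial.natDegree_one] at h3
  have : 0 < 4 * n * (k + 1) := by positivity
  omega

/-- `f(x) = ξ q⁻² ∏_{r ≥ 0} (1 - x ξ^{2r}) (1 - x q⁻² ξ^{2r+1}) (1 - x q² ξ^{2r+1})
(1 - x ξ^{2r+2}) / ((1 - x ξ^{2r+1})² (1 - x q² ξ^{2r+2}) (1 - x q⁻² ξ^{2r}))`. -/
def fSeries (n : ℕ) : K⟦X⟧ :=
  let P : K → K⟦X⟧ := fun a => rescale a (poch (xi n ^ 2))
  C (xi n * q ^ (-2 : ℤ))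
    * (P 1 * P (q ^ (-2 : ℤ) * xi n) * P (q ^ 2 * xi n) * P (xi n ^ 2))
    * (P (xi n) ^ 2 * P (q ^ 2 * xi n ^ 2) * P (q ^ (-2 : ℤ)))⁻¹

/-- The R-matrix `R(x) = f(x) R̄(x)`. -/
def Rmat (n : ℕ) : Matrix (Fin (2 * n) × Fin (2 * n)) (Fin (2 * n) × Fin (2 * n)) K⟦X⟧ :=
  fSeries n • Rbar n

/-- The two signs in `L^±`. -/
inductive Sgn
  | plus
  | minus

/-- The sign as an integer `±1`. -/
def Sgn.toInt : Sgn → ℤ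
  | .plus => 1
  | .minus => -1

/-- Generators: `q^{c/2}`, its inverse, and `l^±_{ij}[∓m]`, `m ≥ 0`. -/
inductive Gen (n : ℕ)
  | c
  | cInv
  | l (ε : Sgn) (i j : Fin (2 * n)) (m : ℕ)

/-- The free algebra on the generators. -/
abbrev Free (n : ℕ) : Type := FreeAlgebra K (Gen n)

/-- The coefficient of `u^r`, `r ∈ ℤ`, in `l^±_{ij}(u) = ∑_{m ≥ 0} l^±_{ij}[∓m] u^{±m}`. -/
def mode {n : ℕ} (ε : Sgn) (i j : Fin (2 * n)) (r : ℤ) : Free n :=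
  if 0 ≤ ε.toInt * r then FreeAlgebra.ι K (Gen.l ε i j r.natAbs) else 0

/-- The coefficient of `u^r v^s` in the `(a, b), (c, d)` entry of `S(u t / v) L^ε_1(u) L^δ_2(v)`,
where `S` is expanded in nonnegative powers of `u t / v`.  (For the sign patterns `++`, `--`
and `+-`, all terms with `k > |r| + |s|` vanish.) -/
def rllLeft {n : ℕ}
    (S : Matrix (Fin (2 * n) × Fin (2 * n)) (Fin (2 * n) × Fin (2 * n)) K⟦X⟧)
    (t : Free n) (ε δ : Sgn) (a b c d : Fin (2 * n)) (r s : ℤ) : Free n :=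
  ∑ k ∈ Finset.range (r.natAbs + s.natAbs + 1), ∑ e, ∑ f,
    coeff k (S (a, b) (e, f)) • (t ^ k * (mode ε e c (r - k) * mode δ f d (s + k)))

/-- The coefficient of `u^r v^s` in the `(a, b), (c, d)` entry of `L^δ_2(v) L^ε_1(u) S(u t / v)`,
where `S` is expanded in nonnegative powers of `u t / v`. -/
def rllRight {n : ℕ}
    (S : Matrix (Fin (2 * n) × Fin (2 * n)) (Fin (2 * n) × Fin (2 * n)) K⟦X⟧)
    (t : Free n) (ε δ : Sgn) (a b c d : Fin (2 * n)) (r s : ℤ) : Free n :=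
  ∑ k ∈ Finset.range (r.natAbs + s.natAbs + 1), ∑ e, ∑ f,
    coeff k (S (e, f) (c, d)) • (mode δ b f (s + k) * mode ε a e (r - k) * t ^ k)

/-- The defining relations of the algebra attached to `S(x)`. -/
inductive Rel (n : ℕ)
    (S : Matrix (Fin (2 * n) × Fin (2 * n)) (Fin (2 * n) × Fin (2 * n)) K⟦X⟧) :
    Free n → Free n → Prop
  | c_mul_cInv : Rel n S (FreeAlgebra.ι K .c * FreeAlgebra.ι K .cInv) 1
  | cInv_mul_c : Rel n S (FreeAlgebra.ι K .cInv * FreeAlgebra.ι K .c) 1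
  | central (g : Gen n) :
      Rel n S (FreeAlgebra.ι K .c * FreeAlgebra.ι K g) (FreeAlgebra.ι K g * FreeAlgebra.ι K .c)
  | plus_zero (i j : Fin (2 * n)) (h : i < j) : Rel n S (FreeAlgebra.ι K (.l .plus i j 0)) 0
  | minus_zero (i j : Fin (2 * n)) (h : i < j) : Rel n S (FreeAlgebra.ι K (.l .minus j i 0)) 0
  -- `l^+_{nn}[0] l^+_{n+1,n+1}[0] = 1`
  | middle (i j : Fin (2 * n)) (hi : (i : ℕ) + 1 = n) (hj : (j : ℕ) = n) :
      Rel n S (FreeAlgebra.ι K (.l .plus i i 0) * FreeAlgebra.ι K (.l .plus j j 0)) 1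
  | diag_plus_minus (i : Fin (2 * n)) :
      Rel n S (FreeAlgebra.ι K (.l .plus i i 0) * FreeAlgebra.ι K (.l .minus i i 0)) 1
  | diag_minus_plus (i : Fin (2 * n)) :
      Rel n S (FreeAlgebra.ι K (.l .minus i i 0) * FreeAlgebra.ι K (.l .plus i i 0)) 1
  -- `S(u / v) L^±_1(u) L^±_2(v) = L^±_2(v) L^±_1(u) S(u / v)`
  | rll_same (ε : Sgn) (a b c d : Fin (2 * n)) (r s : ℤ) :
      Rel n S (rllLeft S 1 ε ε a b c d r s) (rllRight S 1 ε ε a b c d r s)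
  -- `S(u q^c / v) L^+_1(u) L^-_2(v) = L^-_2(v) L^+_1(u) S(u q^{-c} / v)`
  | rll_mixed (a b c d : Fin (2 * n)) (r s : ℤ) :
      Rel n S (rllLeft S (FreeAlgebra.ι K .c ^ 2) .plus .minus a b c d r s)
        (rllRight S (FreeAlgebra.ι K .cInv ^ 2) .plus .minus a b c d r s)

/-- The R-matrix algebra attached to `S(x)`; the algebra `U(R̄^{[n]})` is `U n (Rbar n)` and the
algebra `U(R^{[n]})` is `U n (Rmat n)`. -/
abbrev U (n : ℕ)
    (S : Matrix (Fin (2 * n) × Fin (2 * n)) (Fin (2 * n) × Fin (2 * n)) K⟦X⟧) : Type :=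
  RingQuot (Rel n S)

/-! Series `∑_{m ≥ 0} a_m u^{±m}` are represented by power series in the variable `u^{±1}`. -/

section series

variable {A : Type} [Ring A] [Algebra K A]

/-- The substitution `φ(u) ↦ φ(u a)`, `a ∈ ℂ(q)`, for a power series `φ` in `u` (sign `plus`) or
in `u⁻¹` (sign `minus`). -/
def shift (ε : Sgn) (a : K) (φ : A⟦X⟧) : A⟦X⟧ :=
  PowerSeries.mk fun m => a ^ (ε.toInt * (m : ℤ)) • coeff m φ

/-- The transposition `e_{ij}^t = e_{j'i'}`. -/
def transp {n : ℕ} {B : Type} (M : Matrix (Fin (2 * n)) (Fin (2 * n)) B) :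
    Matrix (Fin (2 * n)) (Fin (2 * n)) B :=
  Matrix.of fun i j => M j.rev i.rev

/-- `D L(u ξ)^t D⁻¹` with `D = diag(q^{1̄}, …, q^{2n̄})`. -/
def conjTransp {n : ℕ} (ε : Sgn) (L : Matrix (Fin (2 * n)) (Fin (2 * n)) A⟦X⟧) :
    Matrix (Fin (2 * n)) (Fin (2 * n)) A⟦X⟧ :=
  Matrix.diagonal (fun i => C (algebraMap K A (q ^ bar i)))
    * transp (L.map (shift ε (xi n)))
    * Matrix.diagonal (fun i => C (algebraMap K A (q ^ (-bar i))))

/-- `z(u)` is the series with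
`D L(u ξ)^t D⁻¹ L(u) = L(u) D L(u ξ)^t D⁻¹ = z(u) 1`. -/
def IsCentralSeries {n : ℕ} (ε : Sgn) (L : Matrix (Fin (2 * n)) (Fin (2 * n)) A⟦X⟧)
    (z : A⟦X⟧) : Prop :=
  conjTransp ε L * L = Matrix.diagonal (fun _ => z) ∧
    L * conjTransp ε L = Matrix.diagonal (fun _ => z)

/-- The data of matrices `F`, `diag(h_1, …, h_{2n})`, `E` over `A⟦u^{±1}⟧`. -/
structure GaussData (n : ℕ) (A : Type) where
  /-- the lower triangular factor -/
  F : Matrix (Fin (2 * n)) (Fin (2 * n)) A⟦X⟧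
  /-- the diagonal entries -/
  h : Fin (2 * n) → A⟦X⟧
  /-- the upper triangular factor -/
  E : Matrix (Fin (2 * n)) (Fin (2 * n)) A⟦X⟧

/-- Gauss decomposition `L = F H E` with `F` lower unitriangular, `H = diag(h_1, …, h_{2n})` and
`E` upper unitriangular. -/
def IsGauss {n : ℕ} (L : Matrix (Fin (2 * n)) (Fin (2 * n)) A⟦X⟧) (G : GaussData n A) : Prop :=
  (∀ i, G.F i i = 1) ∧ (∀ i j, i < j → G.F i j = 0) ∧
  (∀ i, G.E i i = 1) ∧ (∀ i j, j < i → G.E i j = 0) ∧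
  L = G.F * Matrix.diagonal G.h * G.E

/-- The ordered product
`∏_{i=1}^{n-1} h_i(u ξ q^{2i})⁻¹ ∏_{i=1}^{n} h_i(u ξ q^{2i-2}) h_{n+1}(u)`. -/
def centralProduct {n : ℕ} (hn : 1 ≤ n) (ε : Sgn) (h : Fin (2 * n) → A⟦X⟧) : A⟦X⟧ :=
  (List.ofFn fun i : Fin (n - 1) =>
      Ring.inverse (shift ε (xi n * q ^ (2 * ((i : ℕ) + 1))) (h ⟨i, by omega⟩))).prod
    * (List.ofFn fun i : Fin n => shift ε (xi n * q ^ (2 * (i : ℕ))) (h ⟨i, by omega⟩)).prod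
    * h ⟨n, by omega⟩

end series

/-- The matrix `L^±(u) = (l^±_{ij}(u))`, with entries power series in `u^{±1}` over `U n S`. -/
def Lop (n : ℕ)
    (S : Matrix (Fin (2 * n) × Fin (2 * n)) (Fin (2 * n) × Fin (2 * n)) K⟦X⟧) (ε : Sgn) :
    Matrix (Fin (2 * n)) (Fin (2 * n)) (U n S)⟦X⟧ :=
  Matrix.of fun i j => PowerSeries.mk fun m =>
    RingQuot.mkAlgHom K (Rel n S) (FreeAlgebra.ι K (Gen.l ε i j m))

end QAff

end

/-! Existence and uniqueness of the Gauss decomposition is noncommutative Gaussian elimination: the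
constant term of `L^±(u)` is triangular with invertible diagonal, so every pivot is a power series
with invertible constant term.

The exchange relation of `L^±` with itself is used only after specialization. Multiplied by a scalar
series `g`, the R-matrix becomes the polynomial matrix `rPoly`, and the relation can then be
evaluated at `u/v = a` for every nonzero scalar `a` (`eval_double_series`, `rMatrixRel_Lop`). This
covers both algebras, which differ by a scalar factor of `S`. At `a = ξ` the matrix `rPoly` has rank
one, which forces `D L(uξ)^t D⁻¹ L(u)` and `L(u) D L(uξ)^t D⁻¹` to be one and the same scalar matrix
(`RMatrixRel.exists_central`).

For the product formula, substitute `L = F H E` into the first product and cancel `E`. Column `n+1`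
becomes a transposed linear system `∑_j P_{ji}(uξ) y_j = δ_{in} z(u)`, where `P` is the leading `n ×
n` block of `L` and `y_n = h_{n+1}(u)` (`RMatrixRel.central_eq`). On this block no `i` equals a
`j'`, so `P` satisfies type `A` relations (`RMatrixRel.typeARel`). These are inherited by Schur
complements (`TypeARel.schur`). Eliminating one unknown produces a Schur complement with its factors
in the opposite order. At the ratio `q⁻²` it is expressed through the ordinary one with `u` shifted
by `q²` (`TypeARel.opposite_schur`). Each elimination contributes one inverse pivot and one pivot,
and commutation of pivots (`TypeARel.commute_schur`) sorts them into the stated order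
(`eq_pivot_product`). -/

namespace QAff

open PowerSeries

/-! ### Gaussian elimination over a noncommutative ring -/

section LDU

variable {B : Type*} [Ring B] {m : ℕ}

theorem map_ringInverse_of_isUnit {C : Type*} [Ring C] (f : B →+* C) {x : B} (hx : IsUnit x) :
    f (Ring.inverse x) = Ring.inverse (f x) := by
  obtain ⟨u, rfl⟩ := hx
  rw [Ring.inverse_unit, show f (u : B) = (Units.map (f : B →* C) u : C) from rfl,
    Ring.inverse_unit]
  rfl

/-- Holds for every `x`, since `Ring.inverse` is `0` on non-units. -/
theorem commute_ringInverse {c x : B} (h : Commute c x) : Commute c (Ring.inverse x) := by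
  by_cases hx : IsUnit x
  · obtain ⟨u, rfl⟩ := hx
    rw [Ring.inverse_unit]
    exact h.units_inv_right
  · rw [Ring.inverse_non_unit x hx]
    exact Commute.zero_right c

/-- The Schur complement of the first diagonal entry. -/
noncomputable def schur (M : Matrix (Fin (m + 1)) (Fin (m + 1)) B) : Matrix (Fin m) (Fin m) B :=
  Matrix.of fun i j => M i.succ j.succ - M i.succ 0 * Ring.inverse (M 0 0) * M 0 j.succ

theorem schur_apply (M : Matrix (Fin (m + 1)) (Fin (m + 1)) B) (i j : Fin m) :
    schur M i j = M i.succ j.succ - M i.succ 0 * Ring.inverse (M 0 0) * M 0 j.succ := rfl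

/-- The pivots of Gaussian elimination. -/
noncomputable def pivot : ∀ {m : ℕ}, Matrix (Fin m) (Fin m) B → Fin m → B
  | 0, _ => Fin.elim0
  | _ + 1, M => Fin.cons (M 0 0) (pivot (schur M))

@[simp] theorem pivot_zero (M : Matrix (Fin (m + 1)) (Fin (m + 1)) B) : pivot M 0 = M 0 0 := rfl

@[simp] theorem pivot_succ (M : Matrix (Fin (m + 1)) (Fin (m + 1)) B) (i : Fin m) :
    pivot M i.succ = pivot (schur M) i := rfl

/-- All pivots of `M` are invertible. -/
def HasUnitPivots (M : Matrix (Fin m) (Fin m) B) : Prop := ∀ i, IsUnit (pivot M i)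

theorem HasUnitPivots.isUnit {M : Matrix (Fin (m + 1)) (Fin (m + 1)) B} (h : HasUnitPivots M) :
    IsUnit (M 0 0) := h 0

theorem HasUnitPivots.schur {M : Matrix (Fin (m + 1)) (Fin (m + 1)) B} (h : HasUnitPivots M) :
    HasUnitPivots (schur M) := fun i => h i.succ

/-- A matrix which is triangular with invertible diagonal modulo a local homomorphism has
invertible pivots. -/
theorem hasUnitPivots_of_triangular {A : Type*} [Ring A] (π : B →+* A)
    (hπ : ∀ x, IsUnit (π x) → IsUnit x) {m : ℕ} (M : Matrix (Fin m) (Fin m) B)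
    (hd : ∀ i, IsUnit (π (M i i)))
    (ht : (∀ i j, i < j → π (M i j) = 0) ∨ ∀ i j, j < i → π (M i j) = 0) :
    HasUnitPivots M := by
  induction m with
  | zero => exact fun i => i.elim0
  | succ m ih =>
    -- In the correction term of the Schur complement, one of the two outer factors dies under `π`.
    have key : ∀ i j, π (schur M i j) = π (M i.succ j.succ) := by
      intro i j
      rw [schur_apply, map_sub, map_mul, map_mul]
      rcases ht with ht | ht
      · rw [ht 0 j.succ (Fin.succ_pos j), mul_zero, sub_zero]
      · rw [ht i.succ 0 (Fin.succ_pos i), zero_mul, zero_mul, sub_zero]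
    have hs : HasUnitPivots (schur M) := by
      refine ih _ (fun i => ?_) (ht.imp (fun h i j hij => ?_) (fun h i j hij => ?_))
      · rw [key]
        exact hd _
      · rw [key]
        exact h _ _ (Fin.succ_lt_succ_iff.2 hij)
      · rw [key]
        exact h _ _ (Fin.succ_lt_succ_iff.2 hij)
    exact fun i => Fin.cases (hπ _ (hd 0)) hs i

/-- `M = F diag(h) E` with `F` lower and `E` upper unitriangular. -/
structure IsLDU (M F : Matrix (Fin m) (Fin m) B) (h : Fin m → B) (E : Matrix (Fin m) (Fin m) B) :
    Prop where
  F_diag : ∀ i, F i i = 1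
  F_upper : ∀ i j, i < j → F i j = 0
  E_diag : ∀ i, E i i = 1
  E_lower : ∀ i j, j < i → E i j = 0
  eq : M = F * Matrix.diagonal h * E

namespace IsLDU

theorem apply {M F E : Matrix (Fin m) (Fin m) B} {h : Fin m → B} (H : IsLDU M F h E)
    (i j : Fin m) : M i j = ∑ k, F i k * h k * E k j := by
  rw [H.eq, Matrix.mul_apply]
  simp only [Matrix.mul_diagonal]

variable {M F E : Matrix (Fin (m + 1)) (Fin (m + 1)) B} {h : Fin (m + 1) → B}

theorem apply_zero_right (H : IsLDU M F h E) (i : Fin (m + 1)) : M i 0 = F i 0 * h 0 := by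
  rw [H.apply, Fin.sum_univ_succ, H.E_diag, mul_one, add_eq_left]
  exact Finset.sum_eq_zero fun k _ => by rw [H.E_lower _ _ (Fin.succ_pos k), mul_zero]

theorem apply_zero_left (H : IsLDU M F h E) (j : Fin (m + 1)) : M 0 j = h 0 * E 0 j := by
  rw [H.apply, Fin.sum_univ_succ, H.F_diag, one_mul, add_eq_left]
  exact Finset.sum_eq_zero fun k _ => by rw [H.F_upper _ _ (Fin.succ_pos k), zero_mul, zero_mul]

theorem apply_zero (H : IsLDU M F h E) : M 0 0 = h 0 := by
  rw [H.apply_zero_left, H.E_diag, mul_one]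

theorem schur (H : IsLDU M F h E) (hu : IsUnit (h 0)) :
    IsLDU (schur M) (F.submatrix Fin.succ Fin.succ) (fun i => h i.succ)
      (E.submatrix Fin.succ Fin.succ) where
  F_diag i := H.F_diag _
  F_upper i j hij := H.F_upper _ _ (Fin.succ_lt_succ_iff.2 hij)
  E_diag i := H.E_diag _
  E_lower i j hij := H.E_lower _ _ (Fin.succ_lt_succ_iff.2 hij)
  eq := by
    ext i j
    rw [schur_apply, H.apply_zero, H.apply_zero_right, H.apply_zero_left,
      Ring.mul_inverse_cancel_right _ _ hu, H.apply, Fin.sum_univ_succ, Matrix.mul_apply,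
      mul_assoc, add_sub_cancel_left]
    simp only [Matrix.mul_diagonal, Matrix.submatrix_apply]

end IsLDU

theorem IsLDU.unique {m : ℕ} {M F F' E E' : Matrix (Fin m) (Fin m) B} {h h' : Fin m → B}
    (H : IsLDU M F h E) (H' : IsLDU M F' h' E') (hM : HasUnitPivots M) :
    F = F' ∧ h = h' ∧ E = E' := by
  induction m with
  | zero => exact ⟨Subsingleton.elim _ _, Subsingleton.elim _ _, Subsingleton.elim _ _⟩
  | succ m ih =>
    have hu : IsUnit (h 0) := H.apply_zero ▸ hM.isUnit
    have h0 : h 0 = h' 0 := H.apply_zero.symm.trans H'.apply_zero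
    have hu' : IsUnit (h' 0) := h0 ▸ hu
    obtain ⟨hF, hh, hE⟩ := ih (H.schur hu) (H'.schur hu') hM.schur
    refine ⟨?_, ?_, ?_⟩
    · ext i j
      induction j using Fin.cases with
      | zero =>
        have := (H.apply_zero_right i).symm.trans (H'.apply_zero_right i)
        rw [h0] at this
        exact hu'.mul_right_cancel this
      | succ j =>
        induction i using Fin.cases with
        | zero => rw [H.F_upper _ _ (Fin.succ_pos j), H'.F_upper _ _ (Fin.succ_pos j)]
        | succ i => exact congrFun (congrFun hF i) j
    · ext i
      exact Fin.cases h0 (fun i => congrFun hh i) i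
    · ext i j
      induction i using Fin.cases with
      | zero =>
        have := (H.apply_zero_left j).symm.trans (H'.apply_zero_left j)
        rw [h0] at this
        exact hu'.mul_left_cancel this
      | succ i =>
        induction j using Fin.cases with
        | zero => rw [H.E_lower _ _ (Fin.succ_pos i), H'.E_lower _ _ (Fin.succ_pos i)]
        | succ j => exact congrFun (congrFun hE i) j

/-- Used for the leading block of `L`, whose pivots are thereby the series `h_1, …, h_n` of the full
decomposition. -/
theorem IsLDU.pivot_eq {m : ℕ} {M F E : Matrix (Fin m) (Fin m) B} {h : Fin m → B}
    (H : IsLDU M F h E) (hh : ∀ i, IsUnit (h i)) : pivot M = h := by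
  induction m with
  | zero => exact Subsingleton.elim _ _
  | succ m ih =>
    ext i
    exact Fin.cases H.apply_zero
      (fun i => congrFun (ih (H.schur (hh 0)) (fun i => hh i.succ)) i) i

theorem IsLDU.hasUnitPivots {M F E : Matrix (Fin m) (Fin m) B} {h : Fin m → B}
    (H : IsLDU M F h E) (hh : ∀ i, IsUnit (h i)) : HasUnitPivots M := by
  rw [HasUnitPivots, H.pivot_eq hh]
  exact hh

theorem HasUnitPivots.exists_isLDU {m : ℕ} {M : Matrix (Fin m) (Fin m) B} (hM : HasUnitPivots M) :
    ∃ F E, IsLDU M F (pivot M) E := by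
  induction m with
  | zero =>
    exact ⟨0, 0, fun i => i.elim0, fun i => i.elim0, fun i => i.elim0, fun i => i.elim0,
      Subsingleton.elim _ _⟩
  | succ m ih =>
    obtain ⟨F, E, H⟩ := ih hM.schur
    refine ⟨Matrix.of fun i j => Fin.cases
        (Fin.cases 1 (fun i => M i.succ 0 * Ring.inverse (M 0 0)) i)
        (fun j => Fin.cases 0 (fun i => F i j) i) j,
      Matrix.of fun i j => Fin.cases
        (Fin.cases 1 (fun j => Ring.inverse (M 0 0) * M 0 j.succ) j)
        (fun i => Fin.cases 0 (fun j => E i j) j) i, ?_, ?_, ?_, ?_, ?_⟩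
    · exact fun i => Fin.cases rfl (fun i => H.F_diag i) i
    · intro i j hij
      induction j using Fin.cases with
      | zero => exact absurd hij (Fin.not_lt_zero _)
      | succ j =>
        induction i using Fin.cases with
        | zero => rfl
        | succ i => exact H.F_upper _ _ (Fin.succ_lt_succ_iff.1 hij)
    · exact fun i => Fin.cases rfl (fun i => H.E_diag i) i
    · intro i j hij
      induction i using Fin.cases with
      | zero => exact absurd hij (Fin.not_lt_zero _)
      | succ i =>
        induction j using Fin.cases with
        | zero => rfl
        | succ j => exact H.E_lower _ _ (Fin.succ_lt_succ_iff.1 hij)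
    · have hu := hM.isUnit
      ext i j
      rw [Matrix.mul_apply]
      simp only [Matrix.mul_diagonal]
      rw [Fin.sum_univ_succ]
      induction i using Fin.cases with
      | zero =>
        induction j using Fin.cases with
        | zero => simp
        | succ j => simp [Ring.mul_inverse_cancel_left _ _ hu]
      | succ i =>
        induction j using Fin.cases with
        | zero => simp [Ring.inverse_mul_cancel_right _ _ hu]
        | succ j =>
          have := H.apply i j
          rw [schur_apply, sub_eq_iff_eq_add'] at this
          simp [this, Ring.inverse_mul_cancel_right _ _ hu, mul_assoc]

theorem HasUnitPivots.isUnit_of_isLDU {M F E : Matrix (Fin m) (Fin m) B} {h : Fin m → B}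
    (hM : HasUnitPivots M) (H : IsLDU M F h E) (i : Fin m) : IsUnit (h i) := by
  obtain ⟨F', E', H'⟩ := hM.exists_isLDU
  rw [(H.unique H' hM).2.1]
  exact hM i

/-- A nonzero entry `N i j` forces `w j < w i`, so one of `N ^ k` forces `w j + k ≤ w i`, which is
impossible for `k = m`. The weight `w` treats lower and upper triangular matrices alike: the index
for the former, the reversed index for the latter. -/
theorem isNilpotent_of_triangular (N : Matrix (Fin m) (Fin m) B) (w : Fin m → ℕ)
    (hw : ∀ i, w i < m) (hN : ∀ i j, w i ≤ w j → N i j = 0) : IsNilpotent N := by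
  have key : ∀ k i j, w i < w j + k → (N ^ k) i j = 0 := by
    intro k
    induction k with
    | zero =>
      intro i j hij
      rw [pow_zero, Matrix.one_apply_ne]
      rintro rfl
      omega
    | succ k ih =>
      intro i j hij
      rw [pow_succ, Matrix.mul_apply]
      refine Finset.sum_eq_zero fun l _ => ?_
      by_cases hl : w i < w l + k
      · rw [ih _ _ hl, zero_mul]
      · rw [hN l j (by omega), mul_zero]
  refine ⟨m, ?_⟩
  ext i j
  exact key m i j (by have := hw i; omega)

theorem isUnit_of_unitriangular (T : Matrix (Fin m) (Fin m) B) (w : Fin m → ℕ)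
    (hw : ∀ i, w i < m) (hd : ∀ i, T i i = 1) (hT : ∀ i j, i ≠ j → w i ≤ w j → T i j = 0) :
    IsUnit T := by
  have : IsNilpotent (T - 1) := by
    refine isNilpotent_of_triangular _ w hw fun i j hij => ?_
    rcases eq_or_ne i j with rfl | hne
    · rw [Matrix.sub_apply, hd, Matrix.one_apply_eq, sub_self]
    · rw [Matrix.sub_apply, hT i j hne hij, Matrix.one_apply_ne hne, sub_self]
  have := this.isUnit_one_add
  rwa [add_sub_cancel] at this

theorem IsLDU.isUnit_lower {M F E : Matrix (Fin m) (Fin m) B} {h : Fin m → B}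
    (H : IsLDU M F h E) : IsUnit F :=
  isUnit_of_unitriangular F (fun i => i) (fun i => i.2) H.F_diag
    fun i j hij hle => H.F_upper i j (lt_of_le_of_ne hle hij)

theorem IsLDU.isUnit_upper {M F E : Matrix (Fin m) (Fin m) B} {h : Fin m → B}
    (H : IsLDU M F h E) : IsUnit E :=
  isUnit_of_unitriangular E (fun i => i.rev) (fun i => i.rev.2) H.E_diag
    fun i j hij hle => H.E_lower i j (lt_of_le_of_ne (Fin.rev_le_rev.1 hle) hij.symm)

theorem isUnit_diagonal_of {h : Fin m → B} (hh : ∀ i, IsUnit (h i)) :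
    IsUnit (Matrix.diagonal h) := by
  refine ⟨⟨Matrix.diagonal h, Matrix.diagonal fun i => Ring.inverse (h i), ?_, ?_⟩, rfl⟩
  · rw [Matrix.diagonal_mul_diagonal]
    simp [Ring.mul_inverse_cancel _ (hh _)]
  · rw [Matrix.diagonal_mul_diagonal]
    simp [Ring.inverse_mul_cancel _ (hh _)]

theorem HasUnitPivots.isUnit_matrix {M : Matrix (Fin m) (Fin m) B} (hM : HasUnitPivots M) :
    IsUnit M := by
  obtain ⟨F, E, H⟩ := hM.exists_isLDU
  rw [H.eq]
  exact (H.isUnit_lower.mul (isUnit_diagonal_of hM)).mul H.isUnit_upper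

/-- The block of an inverse matrix complementary to the first entry inverts the Schur complement. -/
theorem schur_mul_submatrix {M Z : Matrix (Fin (m + 1)) (Fin (m + 1)) B} (hu : IsUnit (M 0 0))
    (h : M * Z = 1) : schur M * Z.submatrix Fin.succ Fin.succ = 1 := by
  ext i j
  have h0 := congrFun (congrFun h 0) j.succ
  have h1 := congrFun (congrFun h i.succ) j.succ
  rw [Matrix.mul_apply, Fin.sum_univ_succ] at h0 h1
  rw [Matrix.one_apply_ne (Fin.succ_ne_zero j).symm] at h0
  have h2 : Z 0 j.succ = -(Ring.inverse (M 0 0) * ∑ k : Fin m, M 0 k.succ * Z k.succ j.succ) := by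
    rw [← Ring.inverse_mul_cancel_left _ (Z 0 j.succ) hu, eq_neg_of_add_eq_zero_left h0, mul_neg]
  rw [h2] at h1
  rw [Matrix.mul_apply]
  simp only [schur_apply, sub_mul, Finset.sum_sub_distrib, Matrix.submatrix_apply]
  have h3 : (1 : Matrix (Fin (m + 1)) (Fin (m + 1)) B) i.succ j.succ
      = (1 : Matrix (Fin m) (Fin m) B) i j := by
    simp [Matrix.one_apply]
  rw [← h3, ← h1, mul_neg, ← mul_assoc, Finset.mul_sum]
  simp only [← mul_assoc]
  abel

theorem submatrix_mul_schur {M Z : Matrix (Fin (m + 1)) (Fin (m + 1)) B} (hu : IsUnit (M 0 0))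
    (h : Z * M = 1) : Z.submatrix Fin.succ Fin.succ * schur M = 1 := by
  ext i j
  have h0 := congrFun (congrFun h i.succ) 0
  have h1 := congrFun (congrFun h i.succ) j.succ
  rw [Matrix.mul_apply, Fin.sum_univ_succ] at h0 h1
  rw [Matrix.one_apply_ne (Fin.succ_ne_zero i)] at h0
  have h2 : Z i.succ 0 = -((∑ k : Fin m, Z i.succ k.succ * M k.succ 0) * Ring.inverse (M 0 0)) := by
    rw [← Ring.mul_inverse_cancel_right _ (Z i.succ 0) hu, eq_neg_of_add_eq_zero_left h0, neg_mul]
  rw [h2] at h1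
  rw [Matrix.mul_apply]
  simp only [schur_apply, mul_sub, Finset.sum_sub_distrib, Matrix.submatrix_apply]
  have h3 : (1 : Matrix (Fin (m + 1)) (Fin (m + 1)) B) i.succ j.succ
      = (1 : Matrix (Fin m) (Fin m) B) i j := by
    simp [Matrix.one_apply]
  rw [← h3, ← h1, neg_mul, Finset.sum_mul, Finset.sum_mul]
  simp only [← mul_assoc]
  abel

theorem schur_map {C : Type*} [Ring C] (f : B →+* C)
    {M : Matrix (Fin (m + 1)) (Fin (m + 1)) B} (hu : IsUnit (M 0 0)) :
    (schur M).map f = schur (M.map f) := by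
  ext i j
  simp only [Matrix.map_apply, schur_apply, map_sub, map_mul, map_ringInverse_of_isUnit f hu]

theorem commute_schur {c : B} {M : Matrix (Fin (m + 1)) (Fin (m + 1)) B}
    (h : ∀ i j, Commute c (M i j)) (i j : Fin m) : Commute c (schur M i j) :=
  (h _ _).sub_right (((h _ _).mul_right (commute_ringInverse (h _ _))).mul_right (h _ _))

theorem commute_pivot {m : ℕ} {c : B} {M : Matrix (Fin m) (Fin m) B}
    (h : ∀ i j, Commute c (M i j)) (i : Fin m) : Commute c (pivot M i) := by
  induction m with
  | zero => exact i.elim0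
  | succ m ih => exact Fin.cases (h 0 0) (fun i => ih (commute_schur h) i) i

/-- The diagonal matrix with all entries `c` commutes with `Z`, hence with the inverse of `Z` in the
matrix ring. -/
theorem commute_of_inverse {c : B} {M Z : Matrix (Fin m) (Fin m) B} (h1 : M * Z = 1)
    (h2 : Z * M = 1) (h : ∀ i j, Commute c (Z i j)) (i j : Fin m) : Commute c (M i j) := by
  have hZ : Commute (Matrix.diagonal fun _ : Fin m => c) Z := by
    ext i j
    rw [Matrix.diagonal_mul, Matrix.mul_diagonal]
    exact h i j
  let u : (Matrix (Fin m) (Fin m) B)ˣ := ⟨Z, M, h2, h1⟩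
  have hM : Commute (Matrix.diagonal fun _ : Fin m => c) M := hZ.units_inv_right (u := u)
  have := congrFun (congrFun hM.eq i) j
  rwa [Matrix.diagonal_mul, Matrix.mul_diagonal] at this

end LDU

/-! ### Exchange relations with the type `A` R-matrix -/

section TypeA

variable {κ B : Type*} [Field κ] [Ring B] [Algebra κ B]

/-- The diagonal coefficients of the R-matrix of type `A`, without its denominator. -/
def typeABeta {ι : Type*} [LinearOrder ι] (p a : κ) (i j : ι) : κ :=
  if i = j then p * a - p⁻¹ else a - 1

/-- The off-diagonal coefficients of the R-matrix of type `A`, without its denominator. -/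
def typeAGamma {ι : Type*} [LinearOrder ι] (p a : κ) (i j : ι) : κ :=
  if j < i then p - p⁻¹ else if i < j then (p - p⁻¹) * a else 0

/-- The relation `R(a) U₁ V₂ = V₂ U₁ R(a)`, where `R` is the R-matrix of type `A`. -/
def TypeARel {ι : Type*} [LinearOrder ι] (p a : κ) (U V : Matrix ι ι B) : Prop :=
  ∀ i j k l, typeABeta p a i j • (U i k * V j l) + typeAGamma p a i j • (U j k * V i l)
    = typeABeta p a k l • (V j l * U i k) + typeAGamma p a l k • (V j k * U i l)

/-- The relation `U₁ V₂ R(a) = R(a) V₂ U₁`, where `R` is the R-matrix of type `A`. -/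
def TypeAInvRel {ι : Type*} [LinearOrder ι] (p a : κ) (U V : Matrix ι ι B) : Prop :=
  ∀ i j k l, typeABeta p a k l • (U i k * V j l) + typeAGamma p a l k • (U i l * V j k)
    = typeABeta p a i j • (V j l * U i k) + typeAGamma p a i j • (V i l * U j k)

section tensor

variable {ι : Type*} [LinearOrder ι]

/-- `M₁ = M ⊗ 1`. -/
def tensorLeft (M : Matrix ι ι B) : Matrix (ι × ι) (ι × ι) B :=
  Matrix.of fun r s => if r.2 = s.2 then M r.1 s.1 else 0

/-- `M₂ = 1 ⊗ M`. -/
def tensorRight (M : Matrix ι ι B) : Matrix (ι × ι) (ι × ι) B :=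
  Matrix.of fun r s => if r.1 = s.1 then M r.2 s.2 else 0

theorem tensorLeft_one : tensorLeft (1 : Matrix ι ι B) = 1 := by
  ext ⟨i, j⟩ ⟨k, l⟩
  simp only [tensorLeft, Matrix.of_apply, Matrix.one_apply, Prod.mk.injEq]
  split_ifs <;> tauto

theorem tensorRight_one : tensorRight (1 : Matrix ι ι B) = 1 := by
  ext ⟨i, j⟩ ⟨k, l⟩
  simp only [tensorRight, Matrix.of_apply, Matrix.one_apply, Prod.mk.injEq]
  split_ifs <;> tauto

variable [Fintype ι]

/-- The R-matrix of type `A`, without its denominator. -/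
def typeAMatrix (ι B : Type*) [LinearOrder ι] [Ring B] [Algebra κ B] (p a : κ) : Matrix (ι × ι) (ι × ι) B :=
  Matrix.of fun r s => (if r = s then algebraMap κ B (typeABeta p a r.1 r.2) else 0)
    + if r = s.swap then algebraMap κ B (typeAGamma p a r.1 r.2) else 0

theorem typeAMatrix_mul_apply (p a : κ) (N : Matrix (ι × ι) (ι × ι) B) (i j k l : ι) :
    (typeAMatrix ι B p a * N) (i, j) (k, l)
      = typeABeta p a i j • N (i, j) (k, l) + typeAGamma p a i j • N (j, i) (k, l) := by
  have h : ∀ s : ι × ι, ((i, j) = s.swap) = ((j, i) = s) := fun s => by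
    rw [eq_iff_iff]
    constructor
    · intro h
      rw [← Prod.swap_swap s, ← h, Prod.swap_prod_mk]
    · rintro rfl
      rfl
  simp only [Matrix.mul_apply, typeAMatrix, Matrix.of_apply, add_mul, Finset.sum_add_distrib,
    ite_mul, zero_mul, h, Finset.sum_ite_eq, Finset.mem_univ, if_true, Algebra.smul_def]

theorem mul_typeAMatrix_apply (p a : κ) (N : Matrix (ι × ι) (ι × ι) B) (i j k l : ι) :
    (N * typeAMatrix ι B p a) (i, j) (k, l)
      = typeABeta p a k l • N (i, j) (k, l) + typeAGamma p a l k • N (i, j) (l, k) := by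
  simp only [Matrix.mul_apply, typeAMatrix, Matrix.of_apply, mul_add, Finset.sum_add_distrib,
    mul_ite, mul_zero, Prod.swap_prod_mk, Finset.sum_ite_eq', Finset.mem_univ, if_true,
    Algebra.smul_def, Algebra.commutes]

theorem tensorLeft_mul (M N : Matrix ι ι B) :
    tensorLeft (M * N) = tensorLeft M * tensorLeft N := by
  ext ⟨i, j⟩ ⟨k, l⟩
  rw [Matrix.mul_apply, Fintype.sum_prod_type_right]
  by_cases h : j = l <;> simp [Matrix.mul_apply, tensorLeft, h]

theorem tensorRight_mul (M N : Matrix ι ι B) :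
    tensorRight (M * N) = tensorRight M * tensorRight N := by
  ext ⟨i, j⟩ ⟨k, l⟩
  rw [Matrix.mul_apply, Fintype.sum_prod_type]
  by_cases h : i = k <;> simp [Matrix.mul_apply, tensorRight, h]

theorem tensorLeft_mul_tensorRight_apply (M N : Matrix ι ι B) (i j k l : ι) :
    (tensorLeft M * tensorRight N) (i, j) (k, l) = M i k * N j l := by
  simp [Matrix.mul_apply, tensorLeft, tensorRight, Fintype.sum_prod_type]

theorem tensorRight_mul_tensorLeft_apply (M N : Matrix ι ι B) (i j k l : ι) :
    (tensorRight M * tensorLeft N) (i, j) (k, l) = M j l * N i k := by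
  simp [Matrix.mul_apply, tensorLeft, tensorRight, Fintype.sum_prod_type]

theorem typeARel_iff (p a : κ) (U V : Matrix ι ι B) : TypeARel p a U V ↔
    typeAMatrix ι B p a * (tensorLeft U * tensorRight V)
      = tensorRight V * tensorLeft U * typeAMatrix ι B p a := by
  constructor
  · intro h
    ext ⟨i, j⟩ ⟨k, l⟩
    rw [typeAMatrix_mul_apply, mul_typeAMatrix_apply]
    simp only [tensorLeft_mul_tensorRight_apply, tensorRight_mul_tensorLeft_apply]
    exact h i j k l
  · intro h i j k l
    have := congrFun (congrFun h (i, j)) (k, l)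
    rw [typeAMatrix_mul_apply, mul_typeAMatrix_apply] at this
    simpa only [tensorLeft_mul_tensorRight_apply, tensorRight_mul_tensorLeft_apply] using this

theorem typeAInvRel_iff (p a : κ) (U V : Matrix ι ι B) : TypeAInvRel p a U V ↔
    tensorLeft U * tensorRight V * typeAMatrix ι B p a
      = typeAMatrix ι B p a * (tensorRight V * tensorLeft U) := by
  constructor
  · intro h
    ext ⟨i, j⟩ ⟨k, l⟩
    rw [typeAMatrix_mul_apply, mul_typeAMatrix_apply]
    simp only [tensorLeft_mul_tensorRight_apply, tensorRight_mul_tensorLeft_apply]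
    exact h i j k l
  · intro h i j k l
    have := congrFun (congrFun h (i, j)) (k, l)
    rw [typeAMatrix_mul_apply, mul_typeAMatrix_apply] at this
    simpa only [tensorLeft_mul_tensorRight_apply, tensorRight_mul_tensorLeft_apply] using this

/-- The matrix `M ⊗ 1` as a unit. -/
def tensorLeftUnit (M : (Matrix ι ι B)ˣ) : (Matrix (ι × ι) (ι × ι) B)ˣ where
  val := tensorLeft M
  inv := tensorLeft (M⁻¹ : (Matrix ι ι B)ˣ)
  val_inv := by rw [← tensorLeft_mul, Units.mul_inv, tensorLeft_one]
  inv_val := by rw [← tensorLeft_mul, Units.inv_mul, tensorLeft_one]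

/-- The matrix `1 ⊗ M` as a unit. -/
def tensorRightUnit (M : (Matrix ι ι B)ˣ) : (Matrix (ι × ι) (ι × ι) B)ˣ where
  val := tensorRight M
  inv := tensorRight (M⁻¹ : (Matrix ι ι B)ˣ)
  val_inv := by rw [← tensorRight_mul, Units.mul_inv, tensorRight_one]
  inv_val := by rw [← tensorRight_mul, Units.inv_mul, tensorRight_one]

/-- Multiplying `R U₁ V₂ = V₂ U₁ R` by the inverse products on both sides gives `U₁⁻¹ V₂⁻¹ R = R
V₂⁻¹ U₁⁻¹`; `R` itself is never inverted. -/
theorem typeAInvRel_inv_iff (p a : κ) (U V : (Matrix ι ι B)ˣ) :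
    TypeAInvRel p a (U⁻¹ : (Matrix ι ι B)ˣ).1 (V⁻¹ : (Matrix ι ι B)ˣ).1
      ↔ TypeARel p a U.1 V.1 := by
  rw [typeARel_iff, typeAInvRel_iff]
  change ((tensorLeftUnit U)⁻¹ * (tensorRightUnit V)⁻¹ : (Matrix (ι × ι) (ι × ι) B)ˣ).1 * _
    = _ * ((tensorRightUnit V)⁻¹ * (tensorLeftUnit U)⁻¹ : (Matrix (ι × ι) (ι × ι) B)ˣ).1 ↔
    _ * (tensorLeftUnit U * tensorRightUnit V : (Matrix (ι × ι) (ι × ι) B)ˣ).1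
    = (tensorRightUnit V * tensorLeftUnit U : (Matrix (ι × ι) (ι × ι) B)ˣ).1 * _
  rw [← mul_inv_rev, ← mul_inv_rev, Units.inv_mul_eq_iff_eq_mul, ← mul_assoc,
    Units.eq_mul_inv_iff_mul_eq, eq_comm]

/-- The relation between `U(u)` and the inverse of `V(v)`. -/
theorem TypeARel.mixed {p a : κ} {U : Matrix ι ι B} {V : (Matrix ι ι B)ˣ}
    (h : TypeARel p a U V.1) :
    tensorRight (V⁻¹ : (Matrix ι ι B)ˣ).1 * typeAMatrix ι B p a * tensorLeft U
      = tensorLeft U * typeAMatrix ι B p a * tensorRight (V⁻¹ : (Matrix ι ι B)ˣ).1 := by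
  rw [typeARel_iff] at h
  change ((tensorRightUnit V)⁻¹).1 * _ * _ = _ * _ * ((tensorRightUnit V)⁻¹).1
  rw [Units.eq_mul_inv_iff_mul_eq, mul_assoc, mul_assoc, Units.inv_mul_eq_iff_eq_mul]
  change _ * (tensorLeft U * tensorRight V.1) = tensorRight V.1 * (_ * _)
  rw [h, mul_assoc]

end tensor

end TypeA

/-! ### Type `A` relations and Schur complements -/

section TypeAReduction

variable {κ B : Type*} [Field κ] [Ring B] [Algebra κ B] {m : ℕ} {p a : κ}

/-- The Schur complement is the inverse of the lower right block of the inverse matrix. The relation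
for inverses restricts to that block, because the coefficients depend only on the order of the
indices. -/
theorem TypeARel.schur {U V : Matrix (Fin (m + 1)) (Fin (m + 1)) B} (h : TypeARel p a U V)
    (hU : HasUnitPivots U) (hV : HasUnitPivots V) : TypeARel p a (schur U) (schur V) := by
  obtain ⟨u, rfl⟩ := hU.isUnit_matrix
  obtain ⟨v, rfl⟩ := hV.isUnit_matrix
  let u' : (Matrix (Fin m) (Fin m) B)ˣ :=
    ⟨QAff.schur u.1, _, schur_mul_submatrix hU.isUnit u.mul_inv,
      submatrix_mul_schur hU.isUnit u.inv_mul⟩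
  let v' : (Matrix (Fin m) (Fin m) B)ˣ :=
    ⟨QAff.schur v.1, _, schur_mul_submatrix hV.isUnit v.mul_inv,
      submatrix_mul_schur hV.isUnit v.inv_mul⟩
  refine (typeAInvRel_inv_iff p a u' v').1 fun i j k l => ?_
  have := (typeAInvRel_inv_iff p a u v).2 h i.succ j.succ k.succ l.succ
  simp only [typeABeta, typeAGamma, Fin.succ_inj, Fin.succ_lt_succ_iff] at this ⊢
  exact this

/-- It suffices that `U 0 0` commutes with the lower right block of `V⁻¹`, whose inverse is `schur
V`. -/
theorem TypeARel.commute_schur (ha : a ≠ 1) {U V : Matrix (Fin (m + 1)) (Fin (m + 1)) B}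
    (h : TypeARel p a U V) (hV : HasUnitPivots V) (i j : Fin m) :
    Commute (U 0 0) (QAff.schur V i j) := by
  obtain ⟨v, rfl⟩ := hV.isUnit_matrix
  refine commute_of_inverse (schur_mul_submatrix hV.isUnit v.mul_inv)
    (submatrix_mul_schur hV.isUnit v.inv_mul) (fun i j => ?_) i j
  -- In this entry of `V₂⁻¹ R U₁ = U₁ R V₂⁻¹` only the diagonal coefficient `a - 1` of `R` survives.
  have h1 := congrFun (congrFun h.mixed (0, i.succ)) (0, j.succ)
  rw [Matrix.mul_apply, mul_assoc, Matrix.mul_apply, Fintype.sum_prod_type,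
    Fintype.sum_prod_type] at h1
  simp only [mul_typeAMatrix_apply, typeAMatrix_mul_apply] at h1
  simp only [tensorLeft, tensorRight, Matrix.of_apply, (Fin.succ_ne_zero _).symm,
    Fin.succ_ne_zero, if_false, smul_zero, add_zero, mul_ite, ite_mul, mul_zero, zero_mul,
    Finset.sum_ite_eq, Finset.sum_ite_eq', Finset.mem_univ, if_true, smul_ite, typeABeta,
    smul_mul_assoc, mul_smul_comm] at h1
  exact (smul_right_injective B (sub_ne_zero.2 ha) h1).symm

/-- The two Schur complements of the first entry, for the two orders of multiplication. -/
theorem TypeARel.opposite_schur (hp : p ≠ 0) (hp2 : p ^ 2 ≠ 1)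
    {U V : Matrix (Fin (m + 1)) (Fin (m + 1)) B} (h : TypeARel p (p ^ (-2 : ℤ)) U V)
    (hU : IsUnit (U 0 0)) (hV : IsUnit (V 0 0)) (i j : Fin m) :
    V 0 0 * (U i.succ j.succ - U 0 j.succ * Ring.inverse (U 0 0) * U i.succ 0)
      = U 0 0 * QAff.schur V i j := by
  have hd : p - p⁻¹ ≠ 0 := by
    intro h0
    apply hp2
    rw [sq]
    nth_rewrite 2 [sub_eq_zero.1 h0]
    exact mul_inv_cancel₀ hp
  have e0 : p * p ^ (-2 : ℤ) - p⁻¹ = 0 := by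
    rw [zpow_neg]
    norm_cast
    field_simp
    ring
  have e1 : p ^ (-2 : ℤ) - 1 = (p - p⁻¹) * -p⁻¹ := by
    rw [zpow_neg]
    norm_cast
    field_simp
    ring
  -- At `a = p⁻²` the coefficient `p a - p⁻¹` of equal indices vanishes, so the first two entries
  -- become the two-term relations `s1`, `s2`. The third relates the remaining terms. All three
  -- carry the common factor `p - p⁻¹`.
  have r1 := h 0 0 0 j.succ
  have r2 := h i.succ 0 0 0
  have r3 := h i.succ 0 0 j.succ
  simp only [typeABeta, typeAGamma, if_true, (Fin.succ_ne_zero _).symm, Fin.succ_ne_zero, if_false,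
    Fin.succ_pos, lt_irrefl, Fin.not_lt_zero, e0, e1, zero_smul, add_zero, mul_smul,
    ← smul_add] at r1 r2 r3
  replace r1 := smul_right_injective B hd (((smul_zero _).trans r1))
  replace r2 := smul_right_injective B hd (r2.trans (smul_zero _).symm)
  replace r3 := smul_right_injective B hd r3
  simp only [neg_smul] at r1 r2 r3
  have s1 : V 0 0 * U 0 j.succ = p⁻¹ • (V 0 j.succ * U 0 0) := by
    rw [eq_comm, ← sub_eq_zero, ← neg_eq_zero, r1]
    abel
  have s2 : U 0 0 * V i.succ 0 = p⁻¹ • (U i.succ 0 * V 0 0) := by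
    rw [← sub_eq_zero, ← r2]
    abel
  rw [schur_apply, mul_sub, mul_sub, ← mul_assoc, ← mul_assoc, ← mul_assoc, ← mul_assoc, s1, s2,
    smul_mul_assoc, smul_mul_assoc, smul_mul_assoc, smul_mul_assoc,
    Ring.mul_inverse_cancel_right _ _ hU, Ring.mul_inverse_cancel_right _ _ hV]
  rw [sub_eq_neg_add, sub_eq_neg_add]
  exact r3.symm

end TypeAReduction

/-! ### Solving the transposed linear system -/

section TypeAProduct

variable {κ B : Type*} [Field κ] [Ring B] [Algebra κ B] {p : κ}

theorem HasUnitPivots.map {C : Type*} [Ring C] (f : B →+* C) {m : ℕ} {M : Matrix (Fin m) (Fin m) B}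
    (h : HasUnitPivots M) : HasUnitPivots (M.map f) := by
  induction m with
  | zero => exact fun i => i.elim0
  | succ m ih =>
    refine fun i => Fin.cases (h.isUnit.map f) (fun i => ?_) i
    rw [pivot_succ, ← schur_map f h.isUnit]
    exact ih h.schur i

/-- The last entry of a solution of a transposed linear system with a matrix of type `A`. -/
theorem eq_pivot_product (σ : κ →* (B →ₐ[κ] B)) (hp : p ≠ 0) (hpk : ∀ k : ℤ, k ≠ 0 → p ^ k ≠ 1)
    {m : ℕ} (P : Matrix (Fin (m + 1)) (Fin (m + 1)) B) (hP : HasUnitPivots P)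
    (hrel : ∀ k : ℤ, TypeARel p (p ^ k) (P.map (σ (p ^ k))) P) (t : κ) (y : Fin (m + 1) → B) (z : B)
    (hy : ∀ i, ∑ j, σ t (P j i) * y j = if i = Fin.last m then z else 0) :
    z = (List.ofFn fun i : Fin m =>
          Ring.inverse (σ (t * p ^ (2 * ((i : ℕ) + 1))) (pivot P i.castSucc))).prod
      * (List.ofFn fun i : Fin (m + 1) => σ (t * p ^ (2 * (i : ℕ))) (pivot P i)).prod
      * y (Fin.last m) := by
  induction m generalizing t z with
  | zero => simpa using (hy 0).symm
  | succ m ih =>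
    have hu := hP.isUnit
    have hmul : ∀ (a b : κ) (x : B), σ (a * b) x = σ a (σ b x) := fun a b x => by
      rw [map_mul]
      rfl
    set b := σ t (P 0 0) with hb
    set c := σ (t * p ^ 2) (P 0 0) with hc
    have hbu : IsUnit b := hu.map (σ t)
    have hcu : IsUnit c := hu.map (σ (t * p ^ 2))
    have hp2 : p ^ 2 ≠ 1 := by exact_mod_cast hpk 2 (by norm_num)
    have hs : ∀ k : ℤ, TypeARel p (p ^ k) ((schur P).map (σ (p ^ k))) (schur P) := fun k => by
      have := (hrel k).schur (hP.map (σ (p ^ k)).toRingHom) hP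
      rw [show P.map (σ (p ^ k)) = P.map (σ (p ^ k)).toRingHom from rfl, ← schur_map _ hu] at this
      exact this
    have hcomm : ∀ (k : ℤ) (i : Fin (m + 1)), k ≠ 0 →
        Commute (σ (p ^ k) (P 0 0)) (pivot (schur P) i) := fun k i hk =>
      commute_pivot (fun i j => (hrel k).commute_schur (hpk k hk) hP i j) i
    -- This is `opposite_schur` at ratio `p⁻²`, transported by `σ (t * p ^ 2)` so that the shift on
    -- the left becomes `t`.
    have key : ∀ i j : Fin (m + 1),
        c * σ t (P i.succ j.succ - P 0 j.succ * Ring.inverse (P 0 0) * P i.succ 0)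
          = b * σ (t * p ^ 2) (schur P i j) := by
      intro i j
      have := congrArg (σ (t * p ^ 2)) ((hrel (-2)).opposite_schur hp hp2
        (hu.map (σ (p ^ (-2 : ℤ)))) hu i j)
      simp only [Matrix.map_apply] at this
      rw [← AlgHom.coe_toRingHom (σ (p ^ (-2 : ℤ))), ← map_ringInverse_of_isUnit _ hu,
        ← map_mul, ← map_mul, ← map_sub, AlgHom.coe_toRingHom, map_mul (σ (t * p ^ 2)),
        map_mul (σ (t * p ^ 2)), ← hmul (t * p ^ 2), ← hmul (t * p ^ 2)] at this
      rw [show t * p ^ 2 * p ^ (-2 : ℤ) = t by rw [zpow_neg]; norm_cast; field_simp] at this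
      exact this
    have hy0 := hy 0
    rw [Fin.sum_univ_succ, if_neg (Fin.last_pos).ne, ← hb] at hy0
    have hy0' : y 0 = -(Ring.inverse b * ∑ j : Fin (m + 1), σ t (P j.succ 0) * y j.succ) := by
      rw [← Ring.inverse_mul_cancel_left _ (y 0) hbu, eq_neg_of_add_eq_zero_left hy0, mul_neg]
    -- Eliminating `y 0` leaves the opposite Schur complement at `t`. By `key` this is again a
    -- transposed system, for `schur P` at `t * p ^ 2`, with right-hand side `b⁻¹ c z`.
    have hsys : ∀ i : Fin (m + 1), ∑ j : Fin (m + 1), σ (t * p ^ 2) (schur P j i) * y j.succ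
        = if i = Fin.last m then Ring.inverse b * (c * z) else 0 := by
      intro i
      have h1 := hy i.succ
      rw [Fin.sum_univ_succ, hy0'] at h1
      have h2 : ∑ j : Fin (m + 1),
          σ t (P j.succ i.succ - P 0 i.succ * Ring.inverse (P 0 0) * P j.succ 0) * y j.succ
          = if i = Fin.last m then z else 0 := by
        simp only [← Fin.succ_last, Fin.succ_inj] at h1
        rw [← h1, mul_neg, ← mul_assoc, Finset.mul_sum]
        simp only [map_sub, map_mul, sub_mul, Finset.sum_sub_distrib]
        rw [hb, ← AlgHom.coe_toRingHom (σ t), map_ringInverse_of_isUnit _ hu]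
        simp only [mul_assoc]
        abel
      have h3 : b * ∑ j : Fin (m + 1), σ (t * p ^ 2) (schur P j i) * y j.succ
          = c * if i = Fin.last m then z else 0 := by
        rw [← h2, Finset.mul_sum, Finset.mul_sum]
        exact Finset.sum_congr rfl fun j _ => by rw [← mul_assoc, ← mul_assoc, key]
      rw [← Ring.inverse_mul_cancel_left _ (∑ j, _) hbu, h3]
      split_ifs <;> simp
    have h := ih (schur P) hP.schur hs (t * p ^ 2) (fun j => y j.succ) _ hsys
    -- The shift of `b` relative to the `i`-th factor is `p ^ (-(2 * i + 4))`. The exponent is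
    -- nonzero, so `commute_schur` applies.
    have hA : Commute b (List.ofFn fun i : Fin m => Ring.inverse
        (σ (t * p ^ 2 * p ^ (2 * ((i : ℕ) + 1))) (pivot (schur P) i.castSucc))).prod := by
      refine Commute.list_prod_right _ _ fun x hx => ?_
      obtain ⟨i, rfl⟩ := List.mem_ofFn.1 hx
      refine commute_ringInverse ?_
      have := (hcomm (-(2 * (i : ℤ) + 4)) i.castSucc (by omega)).map
        (σ (t * p ^ 2 * p ^ (2 * ((i : ℕ) + 1))))
      rw [← hmul] at this
      convert this using 3
      rw [zpow_neg, show 2 * ((i : ℕ) : ℤ) + 4 = ((2 * (i : ℕ) + 4 : ℕ) : ℤ) by push_cast; ring,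
        zpow_natCast]
      field_simp
      ring
    rw [List.ofFn_succ, List.ofFn_succ, List.prod_cons, List.prod_cons]
    -- The induction hypothesis evaluates `b⁻¹ c z`. Then `c⁻¹` heads the product of inverses, and
    -- `b` moves past the other inverses to head the second product.
    have hz : z = Ring.inverse c * (b * (Ring.inverse b * (c * z))) := by
      rw [Ring.mul_inverse_cancel_left _ _ hbu, Ring.inverse_mul_cancel_left _ _ hcu]
    rw [hz, h, ← mul_assoc b, ← mul_assoc b, hA.eq]
    have e : ∀ k : ℕ, p ^ (2 * (k + 1)) = p ^ 2 * p ^ (2 * k) := fun k => by ring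
    simp only [Fin.val_succ, e, mul_assoc, Fin.castSucc_zero, pivot_zero, Fin.val_zero, mul_zero,
      pow_zero, mul_one, Fin.castSucc_succ, pivot_succ, Fin.succ_last, ← hb, ← hc]

end TypeAProduct

/-! ### Leading blocks and triangular factors -/

section blocks

variable {B : Type*} [Ring B]

/-- For row indices inside the block, triangularity of `F` removes all summands with `k ≥ n`. -/
theorem IsLDU.leading {n N : ℕ} (hn : n ≤ N) {M F E : Matrix (Fin N) (Fin N) B} {h : Fin N → B}
    (H : IsLDU M F h E) :
    IsLDU (M.submatrix (Fin.castLE hn) (Fin.castLE hn)) (F.submatrix (Fin.castLE hn) (Fin.castLE hn))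
      (h ∘ Fin.castLE hn) (E.submatrix (Fin.castLE hn) (Fin.castLE hn)) where
  F_diag i := H.F_diag _
  F_upper i j hij := H.F_upper _ _ hij
  E_diag i := H.E_diag _
  E_lower i j hij := H.E_lower _ _ hij
  eq := by
    ext i j
    rw [Matrix.submatrix_apply, H.apply, Matrix.mul_apply]
    simp only [Matrix.mul_diagonal]
    refine (Fintype.sum_of_injective (Fin.castLE hn) (Fin.castLE_injective hn) _ _ (fun k hk => ?_)
      fun k => rfl).symm
    have : n ≤ (k : ℕ) := by
      by_contra hlt
      exact hk ⟨⟨k, not_le.1 hlt⟩, rfl⟩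
    rw [H.F_upper _ k (Fin.lt_def.2 (lt_of_lt_of_le i.2 this)), zero_mul, zero_mul]

/-- If `X E` is scalar with `E` upper unitriangular, then `X` is upper triangular with the same
diagonal. -/
theorem lower_part_of_mul_unitriangular {N : ℕ} {Y E : Matrix (Fin N) (Fin N) B} {z : B}
    (hd : ∀ i, E i i = 1) (hl : ∀ i j, j < i → E i j = 0)
    (h : Y * E = Matrix.diagonal fun _ => z) (i j : Fin N) (hij : j ≤ i) :
    Y i j = if i = j then z else 0 := by
  induction j using WellFoundedLT.induction with
  | _ j ih =>
    have h1 : ∑ k, Y i k * E k j = if i = j then z else 0 := by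
      rw [← Matrix.mul_apply, h, Matrix.diagonal_apply]
    -- Terms with `k < j` vanish by induction, since then `k < i` strictly; terms with `k > j`
    -- vanish by triangularity of `E`.
    rw [← h1, Finset.sum_eq_single j, hd, mul_one]
    · intro k _ hk
      rcases lt_or_gt_of_ne hk with hlt | hlt
      · rw [ih k hlt (hlt.le.trans hij), if_neg (hlt.trans_le hij).ne', zero_mul]
      · rw [hl k j hlt, mul_zero]
    · exact fun hj => absurd (Finset.mem_univ j) hj

end blocks

/-! ### The substitutions `u ↦ u a` -/

section shiftHom

variable {A : Type} [Ring A] [Algebra K A]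

theorem coeff_shift (ε : Sgn) (a : K) (φ : A⟦X⟧) (m : ℕ) :
    coeff m (shift ε a φ) = (a ^ ε.toInt) ^ m • coeff m φ := by
  rw [shift, coeff_mk, zpow_mul, zpow_natCast]

/-- The substitutions `φ(u) ↦ φ(u a)` as algebra endomorphisms. -/
noncomputable def shiftHom (A : Type) [Ring A] [Algebra K A] (ε : Sgn) : K →* (A⟦X⟧ →ₐ[K] A⟦X⟧) where
  toFun a :=
    { toFun := shift ε a
      map_one' := by
        ext m
        rw [coeff_shift, coeff_one]
        split_ifs with h
        · rw [h, pow_zero, one_smul]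
        · rw [smul_zero]
      map_mul' := fun φ ψ => by
        ext m
        rw [coeff_shift, coeff_mul, coeff_mul, Finset.smul_sum]
        refine Finset.sum_congr rfl fun x hx => ?_
        rw [coeff_shift, coeff_shift, smul_mul_smul_comm, ← pow_add,
          Finset.HasAntidiagonal.mem_antidiagonal.1 hx]
      map_zero' := by
        ext m
        rw [coeff_shift, map_zero, smul_zero]
      map_add' := fun φ ψ => by
        ext m
        rw [coeff_shift, map_add, map_add, smul_add, coeff_shift, coeff_shift]
      commutes' := fun r => by
        ext m
        rw [coeff_shift, PowerSeries.algebraMap_apply, coeff_C]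
        split_ifs with h
        · rw [h, pow_zero, one_smul]
        · rw [smul_zero] }
  map_one' := by
    refine AlgHom.ext fun φ => PowerSeries.ext fun m => ?_
    change coeff m (shift ε 1 φ) = coeff m φ
    rw [coeff_shift, one_zpow, one_pow, one_smul]
  map_mul' a b := by
    refine AlgHom.ext fun φ => PowerSeries.ext fun m => ?_
    change coeff m (shift ε (a * b) φ) = coeff m (shift ε a (shift ε b φ))
    rw [coeff_shift, coeff_shift, coeff_shift, mul_zpow, mul_pow, mul_smul]

theorem shiftHom_apply (ε : Sgn) (a : K) (φ : A⟦X⟧) : shiftHom A ε a φ = shift ε a φ := rfl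

end shiftHom

/-! ### Genericity of `q` and `ξ` -/

section parameters

theorem q_ne_zero : (q : K) ≠ 0 := RatFunc.X_ne_zero

theorem q_pow_ne_one (k : ℕ) (hk : k ≠ 0) : (q : K) ^ k ≠ 1 := by
  intro h
  have h2 : (Polynomial.X : Polynomial ℂ) ^ k = 1 := by
    apply RatFunc.algebraMap_injective ℂ
    rw [map_pow, map_one, RatFunc.algebraMap_X]
    exact h
  have h3 := congrArg Polynomial.natDegree h2
  rw [Polynomial.natDegree_X_pow, Polynomial.natDegree_one] at h3
  exact hk h3

theorem q_zpow_ne_one (k : ℤ) (hk : k ≠ 0) : (q : K) ^ k ≠ 1 := by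
  obtain ⟨m, rfl | rfl⟩ := k.eq_nat_or_neg
  · rw [zpow_natCast]
    exact q_pow_ne_one m (by omega)
  · rw [zpow_neg, zpow_natCast, Ne, inv_eq_one]
    exact q_pow_ne_one m (by omega)

theorem xi_ne_zero (n : ℕ) : xi n ≠ 0 := neg_ne_zero.2 (zpow_ne_zero _ q_ne_zero)

/-- Equality would make a power of `q` equal to `-1`; its square is `1`, so the exponent is `0`, and
then `1 = -1`. Hence shifts by powers of `q` avoid the point where the type `A` part of `rPoly`
vanishes. -/
theorem q_zpow_ne_xi (n : ℕ) (k : ℤ) : (q : K) ^ k ≠ xi n := by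
  intro h
  have h1 : (q : K) ^ (k + 2 * n) = -1 := by
    rw [zpow_add₀ q_ne_zero, h, xi, neg_mul, ← zpow_add₀ q_ne_zero]
    simp
  have h2 : (q : K) ^ (2 * (k + 2 * n)) = 1 := by
    rw [two_mul, zpow_add₀ q_ne_zero, h1]
    norm_num
  by_cases h0 : k + 2 * n = 0
  · rw [h0, zpow_zero] at h1
    exact absurd h1 (by norm_num)
  · exact q_zpow_ne_one _ (by omega) h2

theorem xi_ne_one (n : ℕ) : xi n ≠ 1 := fun h => q_zpow_ne_xi n 0 (by rw [zpow_zero, h])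

end parameters

/-! ### The R-matrix with denominators cleared -/

section rPoly

variable {R : Type*} [CommRing R] [Algebra K R]

/-- The values of the polynomials `a_{ij}(x)`. -/
noncomputable def aPoly (n : ℕ) (x : R) (i j : Fin (2 * n)) : R :=
  if i = j then
    (algebraMap K R (q ^ (-2 : ℤ)) * x - algebraMap K R (xi n)) * (x - 1)
  else if i < j then
    algebraMap K R (q ^ (-2 : ℤ) - 1) * (algebraMap K R (q ^ (bar i - bar j) * xi n) * (x - 1)
      - (if i = j.rev then x - algebraMap K R (xi n) else 0))
  else
    algebraMap K R (q ^ (-2 : ℤ) - 1) * x * (algebraMap K R (q ^ (bar i - bar j)) * (x - 1)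
      - (if i = j.rev then x - algebraMap K R (xi n) else 0))

/-- The polynomial matrix `(x - q⁻²) (x - ξ) R̄(x)`. -/
noncomputable def rPoly (n : ℕ) (x : R) :
    Matrix (Fin (2 * n) × Fin (2 * n)) (Fin (2 * n) × Fin (2 * n)) R :=
  Matrix.of fun r s =>
    (if s.1 = r.1 ∧ s.2 = r.2 ∧ r.1 = r.2 then
      (x - algebraMap K R (q ^ (-2 : ℤ))) * (x - algebraMap K R (xi n)) else 0)
    + (if s.1 = r.1 ∧ s.2 = r.2 ∧ r.1 ≠ r.2 ∧ r.1 ≠ r.2.rev then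
        (x - 1) * (algebraMap K R q⁻¹ * (x - algebraMap K R (xi n))) else 0)
    + (if s.1 = r.2 ∧ s.2 = r.1 ∧ r.2 < r.1 ∧ r.1 ≠ r.2.rev then
        algebraMap K R (q - q⁻¹) * (algebraMap K R q⁻¹ * (x - algebraMap K R (xi n))) else 0)
    + (if s.1 = r.2 ∧ s.2 = r.1 ∧ r.1 < r.2 ∧ r.1 ≠ r.2.rev then
        algebraMap K R (q - q⁻¹) * x
          * (algebraMap K R q⁻¹ * (x - algebraMap K R (xi n))) else 0)
    + (if r.1 = r.2.rev ∧ s.1 = s.2.rev then aPoly n x r.2 s.2 else 0)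

theorem map_aPoly {R' : Type*} [CommRing R'] [Algebra K R'] (f : R →ₐ[K] R') (n : ℕ) (x : R)
    (i j : Fin (2 * n)) : f (aPoly n x i j) = aPoly n (f x) i j := by
  simp only [aPoly, apply_ite f, map_mul, map_sub, map_one, map_zero, AlgHom.commutes]

/-- Naturality identifies `rPoly` over `K⟦X⟧`, over `K[X]`, and at a scalar value of `x`. -/
theorem map_rPoly {R' : Type*} [CommRing R'] [Algebra K R'] (f : R →ₐ[K] R') (n : ℕ) (x : R)
    (r s : Fin (2 * n) × Fin (2 * n)) : f (rPoly n x r s) = rPoly n (f x) r s := by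
  simp only [rPoly, Matrix.of_apply, map_add, apply_ite f, map_mul, map_sub, map_one, map_zero,
    AlgHom.commutes, map_aPoly]

theorem q_inv_mul_sub (x : K) : x - q ^ (-2 : ℤ) = q⁻¹ * (q * x - q⁻¹) := by
  have := q_ne_zero
  rw [zpow_neg]
  norm_cast
  field_simp

theorem rPoly_mul_Rbar (n : ℕ) (r s : Fin (2 * n) × Fin (2 * n)) :
    (X - C (q ^ (-2 : ℤ))) * (X - C (xi n)) * Rbar n r s = rPoly n (X : K⟦X⟧) r s := by
  have h1 : (X - C (q ^ (-2 : ℤ)) : K⟦X⟧) = C q⁻¹ * (C q * X - C q⁻¹) := by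
    rw [mul_sub, ← mul_assoc, ← map_mul, ← map_mul, inv_mul_cancel₀ q_ne_zero, map_one, one_mul,
      zpow_neg, zpow_ofNat, sq, mul_inv]
  have h2 : (C q * X - C q⁻¹ : K⟦X⟧) * (C q * X - C q⁻¹)⁻¹ = 1 :=
    PowerSeries.mul_inv_cancel _ (by simp [q_ne_zero])
  have h3 : (X - C (q ^ (-2 : ℤ))) * (X - C (xi n)) * (C q * X - C q⁻¹ : K⟦X⟧)⁻¹
      = C q⁻¹ * (X - C (xi n)) := by
    rw [h1]
    linear_combination C q⁻¹ * (X - C (xi n)) * h2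
  have h4 : ((X - C (q ^ (-2 : ℤ))) * (X - C (xi n)) : K⟦X⟧)
      * ((X - C (q ^ (-2 : ℤ))) * (X - C (xi n)))⁻¹ = 1 :=
    PowerSeries.mul_inv_cancel _ (by simp [xi_ne_zero, q_ne_zero])
  have ha : aCoef n = aPoly n (X : K⟦X⟧) := rfl
  simp only [Rbar, rPoly, Matrix.of_apply, mul_add, mul_ite, mul_zero, ha]
  refine congrArg₂ _ (congrArg₂ _ (congrArg₂ _ (congrArg₂ _ ?_ ?_) ?_) ?_) ?_
  · rw [mul_one]
    rfl
  · rw [mul_left_comm, h3]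
    rfl
  · rw [mul_left_comm, h3]
    rfl
  · rw [mul_left_comm, h3]
    rfl
  · rw [mul_left_comm, h4, mul_one]

/-- The value at `x = ξ` has rank one. -/
theorem rPoly_xi (n : ℕ) (r s : Fin (2 * n) × Fin (2 * n)) : rPoly n (xi n) r s
    = if r.1 = r.2.rev ∧ s.1 = s.2.rev then
        (q ^ (-2 : ℤ) - 1) * xi n * (xi n - 1) * q ^ (bar r.2 - bar s.2) else 0 := by
  simp only [rPoly, Matrix.of_apply, aPoly, Algebra.algebraMap_self, RingHom.id_apply, sub_self,
    mul_zero, ite_self, zero_add, sub_zero]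
  refine if_congr Iff.rfl ?_ rfl
  split_ifs with h1 h2
  · rw [h1, sub_self, zpow_zero]
    ring
  · ring
  · ring

/-- The excluded entries are exactly those where the last sum of `R̄` can contribute. The common
factor `q⁻¹ (x - ξ)` is what clearing the denominator `q x - q⁻¹` leaves. -/
theorem rPoly_eq_typeA (n : ℕ) (x : K) (r s : Fin (2 * n) × Fin (2 * n))
    (h : ¬(r.1 = r.2.rev ∧ s.1 = s.2.rev)) : rPoly n x r s
    = q⁻¹ * (x - xi n) * ((if s = r then typeABeta q x r.1 r.2 else 0)
      + if s = r.swap then typeAGamma q x r.1 r.2 else 0) := by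
  obtain ⟨a, b⟩ := r
  obtain ⟨c, d⟩ := s
  simp only at h
  simp only [rPoly, Matrix.of_apply, if_neg h, add_zero, Algebra.algebraMap_self, RingHom.id_apply,
    q_inv_mul_sub, Prod.swap_prod_mk, Prod.mk.injEq, typeABeta, typeAGamma]
  by_cases h1 : c = a ∧ d = b
  · obtain ⟨rfl, rfl⟩ := h1
    have hr : c ≠ d.rev := fun hr => h ⟨hr, hr⟩
    by_cases hcd : c = d
    · subst hcd
      simp [hr]
      ring
    · simp [hr, hcd]
      ring
  · by_cases h2 : c = b ∧ d = a
    · obtain ⟨rfl, rfl⟩ := h2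
      have hr : d ≠ c.rev := fun hr => h ⟨hr, by rw [hr, Fin.rev_rev]⟩
      have hcd : c ≠ d := fun e => h1 ⟨e, e.symm⟩
      rcases lt_or_gt_of_ne hcd with hlt | hlt
      · simp [hr, hcd, hcd.symm, hlt, hlt.not_gt]
        ring
      · simp [hr, hcd, hcd.symm, hlt, hlt.not_gt]
        ring
    · have h1' : ∀ P : Prop, ¬(c = a ∧ d = b ∧ P) := fun P hP => h1 ⟨hP.1, hP.2.1⟩
      have h2' : ∀ P : Prop, ¬(c = b ∧ d = a ∧ P) := fun P hP => h2 ⟨hP.1, hP.2.1⟩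
      simp only [h1, h2, h1', h2', if_false, add_zero, mul_zero]

end rPoly

/-! ### The central series and its factorization -/

section central

variable {A : Type} [Ring A] [Algebra K A] {n : ℕ} {ε : Sgn}

/-- The relation `R(a) L₁(ua) L₂(u) = L₂(u) L₁(ua) R(a)` for the numerator `R` of the R-matrix and
all scalars `a ≠ 0`. -/
def RMatrixRel (ε : Sgn) (L : Matrix (Fin (2 * n)) (Fin (2 * n)) A⟦X⟧) : Prop :=
  ∀ a : K, a ≠ 0 → ∀ i j k l,
    ∑ e, ∑ f, rPoly n a (i, j) (e, f) • (shift ε a (L e k) * L f l)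
      = ∑ e, ∑ f, rPoly n a (e, f) (k, l) • (L j f * shift ε a (L i e))

theorem conjTransp_apply (L : Matrix (Fin (2 * n)) (Fin (2 * n)) A⟦X⟧) (i k : Fin (2 * n)) :
    conjTransp ε L i k = q ^ (bar i - bar k) • shift ε (xi n) (L k.rev i.rev) := by
  rw [conjTransp, Matrix.mul_diagonal, Matrix.diagonal_mul, ← PowerSeries.algebraMap_apply,
    ← PowerSeries.algebraMap_apply, ← Algebra.smul_def, ← Algebra.commutes, ← Algebra.smul_def,
    smul_smul, ← zpow_add₀ q_ne_zero, sub_eq_neg_add]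
  rfl

/-- At `a = ξ` the left side of the exchange relation is supported on `h = j` and the right side on
`g = l`, because `rPoly` has rank one there. Comparing the two supports makes both products scalar.
-/
theorem RMatrixRel.rank_one {L : Matrix (Fin (2 * n)) (Fin (2 * n)) A⟦X⟧} (H : RMatrixRel ε L)
    (g h j l : Fin (2 * n)) :
    (if h = j then q ^ (bar j - bar g) • (conjTransp ε L * L) g l else 0)
      = if g = l then q ^ (bar h - bar l) • (L * conjTransp ε L) j h else 0 := by
  obtain ⟨c, hc, hr⟩ : ∃ c : K, c ≠ 0 ∧ ∀ r s, rPoly n (xi n) r s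
      = if r.1 = r.2.rev ∧ s.1 = s.2.rev then c * q ^ (bar r.2 - bar s.2) else 0 :=
    ⟨_, mul_ne_zero (mul_ne_zero (sub_ne_zero.2 (q_zpow_ne_one _ (by norm_num))) (xi_ne_zero n))
      (sub_ne_zero.2 (xi_ne_one n)), rPoly_xi n⟩
  -- The first row and column indices are reversed so that the sums become entries of products with
  -- `conjTransp ε L`, whose definition also reverses indices.
  have h0 := H (xi n) (xi_ne_zero n) h.rev j g.rev l
  rw [Finset.sum_comm] at h0
  conv_rhs at h0 => rw [Finset.sum_comm]
  refine smul_right_injective _ hc ?_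
  convert h0 using 1
  · by_cases e : h = j
    · subst e
      simp only [hr, true_and, if_true, ite_smul, zero_smul, Finset.sum_ite_eq', Finset.mem_univ,
        mul_smul, ← Finset.smul_sum, Matrix.mul_apply]
      congr 1
      rw [Finset.smul_sum]
      refine Finset.sum_congr rfl fun f _ => ?_
      rw [conjTransp_apply, smul_mul_assoc, smul_smul, ← zpow_add₀ q_ne_zero, sub_add_sub_cancel]
    · simp [hr, e]
  · by_cases e : g = l
    · subst e
      simp only [hr, and_true, if_true, ite_smul, zero_smul, Finset.sum_ite_eq', Finset.mem_univ,
        mul_smul, ← Finset.smul_sum, Matrix.mul_apply]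
      congr 1
      rw [Finset.smul_sum]
      refine Finset.sum_congr rfl fun f _ => ?_
      rw [conjTransp_apply, mul_smul_comm, smul_smul, ← zpow_add₀ q_ne_zero, add_comm,
        sub_add_sub_cancel]
    · simp [hr, e]

theorem RMatrixRel.exists_central (hn : 1 ≤ n) {L : Matrix (Fin (2 * n)) (Fin (2 * n)) A⟦X⟧}
    (H : RMatrixRel ε L) : ∃! z, IsCentralSeries ε L z := by
  have hq : ∀ k : ℤ, (q : K) ^ k ≠ 0 := fun k => zpow_ne_zero k q_ne_zero
  have h1 : ∀ g l, g ≠ l → (conjTransp ε L * L) g l = 0 := fun g l hgl => by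
    have := H.rank_one g g g l
    rw [if_pos rfl, if_neg hgl, sub_self, zpow_zero, one_smul] at this
    exact this
  have h2 : ∀ j h, j ≠ h → (L * conjTransp ε L) j h = 0 := fun j h hjh => by
    have := H.rank_one h h j h
    rw [if_pos rfl, if_neg hjh.symm, sub_self, zpow_zero, one_smul] at this
    exact this.symm
  have h3 : ∀ g j, (conjTransp ε L * L) g g = (L * conjTransp ε L) j j := fun g j => by
    have := H.rank_one g j j g
    rw [if_pos rfl, if_pos rfl] at this
    exact smul_right_injective _ (hq _) this
  let o : Fin (2 * n) := ⟨0, by omega⟩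
  refine ⟨(conjTransp ε L * L) o o, ⟨?_, ?_⟩, fun z hz => ?_⟩
  · ext1 g l
    rw [Matrix.diagonal_apply]
    split_ifs with hgl
    · rw [← hgl, h3 g o, h3 o o]
    · exact h1 g l hgl
  · ext1 g l
    rw [Matrix.diagonal_apply]
    split_ifs with hgl
    · rw [← hgl, h3 o g]
    · exact h2 g l hgl
  · rw [hz.1, Matrix.diagonal_apply_eq]

/-- Two indices among the first `n` are never exchanged by `Fin.rev`, so only type `A` entries
occur; the factor `q⁻¹ (a - ξ)` is nonzero and cancels. -/
theorem RMatrixRel.typeARel {L : Matrix (Fin (2 * n)) (Fin (2 * n)) A⟦X⟧} (H : RMatrixRel ε L)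
    {hn : n ≤ 2 * n} {a : K} (ha : a ≠ 0) (hxi : a ≠ xi n) :
    TypeARel q a ((L.submatrix (Fin.castLE hn) (Fin.castLE hn)).map (shiftHom A ε a))
      (L.submatrix (Fin.castLE hn) (Fin.castLE hn)) := by
  have hrev : ∀ i j : Fin n, Fin.castLE hn i ≠ (Fin.castLE hn j).rev := fun i j h => by
    have := congrArg Fin.val h
    rw [Fin.val_rev, Fin.val_castLE, Fin.val_castLE] at this
    omega
  intro i j k l
  have h := H a ha (Fin.castLE hn i) (Fin.castLE hn j) (Fin.castLE hn k) (Fin.castLE hn l)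
  obtain ⟨c, hc, hr⟩ : ∃ c : K, c ≠ 0 ∧ ∀ r s : Fin (2 * n) × Fin (2 * n),
      ¬(r.1 = r.2.rev ∧ s.1 = s.2.rev) → rPoly n a r s
        = c * ((if s = r then typeABeta q a r.1 r.2 else 0)
          + if s = r.swap then typeAGamma q a r.1 r.2 else 0) :=
    ⟨_, mul_ne_zero (inv_ne_zero q_ne_zero) (sub_ne_zero.2 hxi), rPoly_eq_typeA n a⟩
  have e1 : ∀ s, rPoly n a (Fin.castLE hn i, Fin.castLE hn j) s = _ := fun s =>
    hr _ s fun h => hrev i j h.1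
  have e2 : ∀ r, rPoly n a r (Fin.castLE hn k, Fin.castLE hn l) = _ := fun r =>
    hr r _ fun h => hrev k l h.2
  have hsw : ∀ r : Fin (2 * n) × Fin (2 * n), ((Fin.castLE hn k, Fin.castLE hn l) = r.swap)
      = ((Fin.castLE hn l, Fin.castLE hn k) = r) := fun r => by
    rw [eq_iff_iff]
    exact ⟨fun h => by rw [← Prod.swap_swap r, ← h, Prod.swap_prod_mk], fun h => by
      rw [← h, Prod.swap_prod_mk]⟩
  rw [← Fintype.sum_prod_type' (f := fun e f => rPoly n a (_, _) (e, f) • _),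
    ← Fintype.sum_prod_type' (f := fun e f => rPoly n a (e, f) (_, _) • _)] at h
  simp only [Prod.mk.eta, e1, e2, mul_smul, ← Finset.smul_sum, add_smul, ite_smul, zero_smul,
    Finset.sum_add_distrib, hsw, Finset.sum_ite_eq, Finset.sum_ite_eq', Finset.mem_univ,
    if_true, Prod.swap_prod_mk] at h
  simp only [typeABeta, typeAGamma, Fin.castLE_inj, Fin.castLE_lt_castLE_iff] at h ⊢
  exact smul_right_injective _ hc h

theorem RMatrixRel.central_eq {L : Matrix (Fin (2 * n)) (Fin (2 * n)) A⟦X⟧} (hn : 1 ≤ n)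
    (H : RMatrixRel ε L) {G : GaussData n A} (hG : IsLDU L G.F G.h G.E)
    (hh : ∀ i, IsUnit (G.h i)) {z : A⟦X⟧} (hz : IsCentralSeries ε L z) :
    z = centralProduct hn ε G.h := by
  obtain ⟨m, rfl⟩ : ∃ m, n = m + 1 := ⟨n - 1, by omega⟩
  have hle : m + 1 ≤ 2 * (m + 1) := by omega
  have hlead := hG.leading hle
  set P := L.submatrix (Fin.castLE hle) (Fin.castLE hle) with hP
  have hpiv := hlead.pivot_eq fun i => hh _
  let c : Fin (2 * (m + 1)) := ⟨m + 1, by omega⟩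
  -- `ρ` enumerates the rows from `c` on in reverse order. Under the transposition these rows of
  -- `conjTransp ε L` read off the leading block `P`, and the last unknown sits at `c`.
  let ρ : Fin (m + 1) → Fin (2 * (m + 1)) := fun j => (Fin.castLE hle j).rev
  have hρ : Function.Injective ρ := Fin.rev_injective.comp (Fin.castLE_injective hle)
  have hlast : ρ (Fin.last m) = c := by
    ext
    simp only [ρ, c, Fin.val_rev, Fin.val_castLE, Fin.val_last]
    omega
  have hcρ : ∀ j, c ≤ ρ j := fun j => by
    have := j.2
    simp only [ρ, c, Fin.le_def, Fin.val_rev, Fin.val_castLE]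
    omega
  have hbar : bar c = 0 := by simp [bar, c]
  have hY : conjTransp ε L * G.F * Matrix.diagonal G.h * G.E = Matrix.diagonal fun _ => z := by
    rw [mul_assoc, mul_assoc, ← mul_assoc G.F, ← hG.eq, hz.1]
  -- Column `c` of `(D L(uξ)^t D⁻¹) F H`, on and below the diagonal.
  have key := fun i => lower_part_of_mul_unitriangular hG.E_diag hG.E_lower hY (ρ i) c (hcρ i)
  have h := eq_pivot_product (shiftHom A ε) q_ne_zero q_zpow_ne_one P
    (hlead.hasUnitPivots fun i => hh _)
    (fun k => H.typeARel (zpow_ne_zero k q_ne_zero) (q_zpow_ne_xi _ k)) (xi (m + 1))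
    (fun j => (q : K) ^ (-bar (ρ j)) • (G.F (ρ j) c * G.h c)) z fun i => ?_
  · rw [hlast, hbar, neg_zero, zpow_zero, one_smul, hG.F_diag, one_mul, hpiv] at h
    exact h
  · have hk := key i
    rw [Matrix.mul_diagonal, Matrix.mul_apply, Finset.sum_mul] at hk
    rw [← Fintype.sum_of_injective ρ hρ
      (fun j => (q : K) ^ bar (ρ i) • (shiftHom A ε (xi (m + 1)) (P j i)
        * ((q : K) ^ (-bar (ρ j)) • (G.F (ρ j) c * G.h c)))) _ ?_ ?_] at hk
    · rw [← Finset.smul_sum] at hk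
      have hq : (q : K) ^ bar (ρ i) ≠ 0 := zpow_ne_zero _ q_ne_zero
      refine smul_right_injective _ hq (hk.trans ?_)
      rw [← hlast]
      simp only [hρ.eq_iff]
      split_ifs with hi
      · rw [hi, hlast, hbar, zpow_zero, one_smul]
      · rw [smul_zero]
    -- A row outside the range of `ρ` lies above `c`, where column `c` of `F` vanishes.
    · intro k hkr
      rw [hG.F_upper k c, mul_zero, zero_mul]
      by_contra hck
      refine hkr ⟨⟨k.rev, ?_⟩, ?_⟩
      · have := Fin.le_def.1 (not_lt.1 hck)
        have := k.2
        simp only [c] at *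
        rw [Fin.val_rev]
        omega
      · exact Fin.rev_rev k
    · intro j
      rw [conjTransp_apply, sub_eq_add_neg, zpow_add₀ q_ne_zero, mul_smul, smul_mul_assoc,
        smul_mul_assoc, smul_mul_assoc, smul_mul_assoc, mul_smul_comm, mul_assoc, shiftHom_apply]
      simp only [ρ, Fin.rev_rev]
      rfl

end central

/-! ### From formal double series to scalar specializations -/

section RLL

variable {A : Type} [Ring A]

/-- The coefficient of `u^r`, `r ∈ ℤ`, of a series in `u^{±1}`. -/
noncomputable def intCoeff (ε : Sgn) (φ : A⟦X⟧) (r : ℤ) : A :=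
  if 0 ≤ ε.toInt * r then coeff r.natAbs φ else 0

theorem intCoeff_of_nonneg {ε : Sgn} {r : ℤ} (h : 0 ≤ ε.toInt * r) (φ : A⟦X⟧) {k : ℕ}
    (hk : r.natAbs = k) : intCoeff ε φ r = coeff k φ := by
  rw [intCoeff, if_pos h, hk]

theorem intCoeff_of_neg {ε : Sgn} {r : ℤ} (h : ε.toInt * r < 0) (φ : A⟦X⟧) :
    intCoeff ε φ r = 0 := by
  rw [intCoeff, if_neg (not_le.2 h)]

variable [Algebra K A]

/-- The exponent of `u / v` in a term `u^{±i} v^{±j}`, relative to the lowest exponent. -/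
def ratioExp (ε : Sgn) (p : ℕ × ℕ) : ℕ :=
  match ε with
  | .plus => p.1
  | .minus => p.2

/-- The part of total degree `±m` of `β(φ(u), ψ(v))`, as a polynomial in `u / v`. -/
noncomputable def bilinPoly (ε : Sgn) (m : ℕ) (β : A →ₗ[K] A →ₗ[K] A) (φ ψ : A⟦X⟧) :
    Polynomial A :=
  ∑ p ∈ Finset.HasAntidiagonal.antidiagonal m,
    Polynomial.monomial (ratioExp ε p) (β (coeff p.1 φ) (coeff p.2 ψ))

/-- The exponent of `u` in the term of total degree `±m` with relative exponent `i` of `u / v`. -/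
def leftExp (ε : Sgn) (m i : ℕ) : ℤ :=
  match ε with
  | .plus => i
  | .minus => (i : ℤ) - m

/-- The exponent of `v` in the term of total degree `±m` with relative exponent `i` of `u / v`. -/
def rightExp (ε : Sgn) (m i : ℕ) : ℤ :=
  match ε with
  | .plus => (m : ℤ) - i
  | .minus => -(i : ℤ)

theorem coeff_bilinPoly (ε : Sgn) (m j : ℕ) (β : A →ₗ[K] A →ₗ[K] A) (φ ψ : A⟦X⟧) :
    (bilinPoly ε m β φ ψ).coeff j
      = β (intCoeff ε φ (leftExp ε m j)) (intCoeff ε ψ (rightExp ε m j)) := by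
  rw [bilinPoly, Polynomial.finsetSum_coeff]
  simp only [Polynomial.coeff_monomial]
  by_cases h : j ≤ m
  · obtain ⟨p, hp, hpj, hpu⟩ : ∃ p ∈ Finset.HasAntidiagonal.antidiagonal m, ratioExp ε p = j ∧
        ∀ p' ∈ Finset.HasAntidiagonal.antidiagonal m, ratioExp ε p' = j → p' = p := by
      cases ε with
      | plus =>
        refine ⟨(j, m - j), ?_, rfl, fun p' hp' h' => ?_⟩
        · rw [Finset.HasAntidiagonal.mem_antidiagonal]
          exact Nat.add_sub_cancel' h
        · rw [Finset.HasAntidiagonal.mem_antidiagonal] at hp'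
          change p'.1 = j at h'
          exact Prod.ext h' (by simp only; omega)
      | minus =>
        refine ⟨(m - j, j), ?_, rfl, fun p' hp' h' => ?_⟩
        · rw [Finset.HasAntidiagonal.mem_antidiagonal]
          exact Nat.sub_add_cancel h
        · rw [Finset.HasAntidiagonal.mem_antidiagonal] at hp'
          change p'.2 = j at h'
          exact Prod.ext (by simp only; omega) h'
    rw [Finset.sum_eq_single_of_mem p hp fun p' hp' hne => if_neg fun h' => hne (hpu p' hp' h'),
      if_pos hpj]
    rw [Finset.HasAntidiagonal.mem_antidiagonal] at hp
    have h1 : 0 ≤ ε.toInt * leftExp ε m j ∧ (leftExp ε m j).natAbs = p.1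
        ∧ 0 ≤ ε.toInt * rightExp ε m j ∧ (rightExp ε m j).natAbs = p.2 := by
      cases ε <;> simp only [ratioExp, Sgn.toInt, leftExp, rightExp] at * <;> omega
    rw [intCoeff_of_nonneg h1.1 φ h1.2.1, intCoeff_of_nonneg h1.2.2.1 ψ h1.2.2.2]
  · rw [Finset.sum_eq_zero fun p hp => if_neg ?_]
    · cases ε with
      | plus =>
        rw [intCoeff_of_neg (r := rightExp .plus m j), map_zero]
        simp only [rightExp, Sgn.toInt]
        omega
      | minus =>
        rw [intCoeff_of_neg (r := leftExp .minus m j), map_zero, LinearMap.zero_apply]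
        simp only [leftExp, Sgn.toInt]
        omega
    · rw [Finset.HasAntidiagonal.mem_antidiagonal] at hp
      cases ε <;> simp only [ratioExp] <;> omega

theorem leftExp_sub (ε : Sgn) (m i k : ℕ) (h : k ≤ i) :
    leftExp ε m i - k = leftExp ε m (i - k) := by
  cases ε <;> simp only [leftExp] <;> omega

theorem rightExp_add (ε : Sgn) (m i k : ℕ) (h : k ≤ i) :
    rightExp ε m i + k = rightExp ε m (i - k) := by
  cases ε <;> simp only [rightExp] <;> omega

/-- The double series `∑ S_k (u/v)^k β(φ(u), ψ(v))` in terms of power series in `u / v`. -/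
theorem sum_range_intCoeff (ε : Sgn) (m i : ℕ) (β : A →ₗ[K] A →ₗ[K] A) (φ ψ : A⟦X⟧) (S : K⟦X⟧) :
    ∑ k ∈ Finset.range ((leftExp ε m i).natAbs + (rightExp ε m i).natAbs + 1),
      coeff k S • β (intCoeff ε φ (leftExp ε m i - k)) (intCoeff ε ψ (rightExp ε m i + k))
      = coeff i (PowerSeries.map (algebraMap K A) S * (bilinPoly ε m β φ ψ : A⟦X⟧)) := by
  have hsub : Finset.range (i + 1)
      ⊆ Finset.range ((leftExp ε m i).natAbs + (rightExp ε m i).natAbs + 1) := by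
    apply Finset.range_subset_range.2
    cases ε <;> simp only [leftExp, rightExp] <;> omega
  rw [← Finset.sum_subset hsub, coeff_mul, Finset.Nat.sum_antidiagonal_eq_sum_range_succ_mk]
  · refine Finset.sum_congr rfl fun k hk => ?_
    have hk' : k ≤ i := Nat.lt_succ_iff.1 (Finset.mem_range.1 hk)
    rw [PowerSeries.coeff_map, Polynomial.coeff_coe, coeff_bilinPoly, leftExp_sub ε m i k hk',
      rightExp_add ε m i k hk', Algebra.smul_def]
  · intro k _ hk
    have hk' : i < k := by simpa [Nat.lt_succ_iff] using hk
    have : intCoeff ε φ (leftExp ε m i - k) = 0 ∨ intCoeff ε ψ (rightExp ε m i + k) = 0 := by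
      cases ε with
      | plus =>
        left
        apply intCoeff_of_neg
        simp only [leftExp, Sgn.toInt]
        omega
      | minus =>
        right
        apply intCoeff_of_neg
        simp only [rightExp, Sgn.toInt]
        omega
    rcases this with h | h
    · rw [h, map_zero, LinearMap.zero_apply, smul_zero]
    · rw [h, map_zero, smul_zero]

/-- Evaluation of polynomials with noncommuting coefficients at a scalar. -/
noncomputable def evalScalar (A : Type) [Ring A] [Algebra K A] (a : K) : Polynomial A →+* A :=
  Polynomial.eval₂RingHom' (RingHom.id A) (algebraMap K A a) fun x => (Algebra.commutes a x).symm

theorem evalScalar_monomial (a : K) (k : ℕ) (x : A) :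
    evalScalar A a (Polynomial.monomial k x) = a ^ k • x := by
  change Polynomial.eval₂ _ _ _ = _
  rw [Polynomial.eval₂_monomial, RingHom.id_apply, ← map_pow, ← Algebra.commutes,
    Algebra.smul_def]

theorem evalScalar_map (a : K) (p : Polynomial K) :
    evalScalar A a (p.map (algebraMap K A)) = algebraMap K A (p.eval a) := by
  change Polynomial.eval₂ _ _ _ = _
  rw [Polynomial.eval₂_map, RingHom.id_comp, Polynomial.eval₂_at_apply]

/-- The factor between evaluations at `u / v = a` and substitutions `u ↦ u a`. -/
noncomputable def evalFactor (ε : Sgn) (m : ℕ) (a : K) : K :=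
  match ε with
  | .plus => 1
  | .minus => a ^ m

theorem evalFactor_ne_zero (ε : Sgn) (m : ℕ) {a : K} (ha : a ≠ 0) : evalFactor ε m a ≠ 0 := by
  cases ε
  · exact one_ne_zero
  · exact pow_ne_zero m ha

theorem evalScalar_bilinPoly (ε : Sgn) (m : ℕ) (β : A →ₗ[K] A →ₗ[K] A) (φ ψ : A⟦X⟧) {a : K}
    (ha : a ≠ 0) : evalScalar A a (bilinPoly ε m β φ ψ)
      = evalFactor ε m a • ∑ p ∈ Finset.HasAntidiagonal.antidiagonal m,
          β (coeff p.1 (shift ε a φ)) (coeff p.2 ψ) := by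
  rw [bilinPoly, map_sum, Finset.smul_sum]
  refine Finset.sum_congr rfl fun p hp => ?_
  rw [Finset.HasAntidiagonal.mem_antidiagonal] at hp
  rw [evalScalar_monomial, coeff_shift, map_smul, LinearMap.smul_apply, smul_smul]
  congr 1
  cases ε with
  | plus => simp [ratioExp, evalFactor, Sgn.toInt]
  | minus =>
    -- Here `(u/v)^j` with `j = p.2` evaluates to `a ^ p.2 = a ^ m * a⁻¹ ^ p.1`, and the second
    -- factor is the effect of the shift.
    simp only [ratioExp, evalFactor, Sgn.toInt, zpow_neg_one]
    rw [← hp, pow_add, inv_pow, mul_right_comm, mul_inv_cancel₀ (pow_ne_zero _ ha), one_mul]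

theorem sum_mul_eq (m : ℕ) (φ ψ : A⟦X⟧) :
    ∑ p ∈ Finset.HasAntidiagonal.antidiagonal m, LinearMap.mul K A (coeff p.1 φ) (coeff p.2 ψ)
      = coeff m (φ * ψ) := by
  rw [coeff_mul]
  rfl

theorem sum_mul_flip_eq (m : ℕ) (φ ψ : A⟦X⟧) :
    ∑ p ∈ Finset.HasAntidiagonal.antidiagonal m, (LinearMap.mul K A).flip (coeff p.1 φ) (coeff p.2 ψ)
      = coeff m (ψ * φ) := by
  rw [coeff_mul, ← Finset.Nat.sum_antidiagonal_swap]
  rfl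

/-- Passage from an identity of double series to its specializations `u ↦ u a`. -/
theorem eval_double_series {ι ι' : Type} [Fintype ι] [Fintype ι'] (ε : Sgn) (m : ℕ)
    (β β' : A →ₗ[K] A →ₗ[K] A) (φ ψ : ι → A⟦X⟧) (φ' ψ' : ι' → A⟦X⟧) (S : ι → K⟦X⟧) (S' : ι' → K⟦X⟧)
    (T : ι → Polynomial K) (T' : ι' → Polynomial K) (g : K⟦X⟧) (hT : ∀ s, g * S s = T s)
    (hT' : ∀ s, g * S' s = T' s)
    (h : ∀ i : ℕ,
      ∑ s, ∑ k ∈ Finset.range ((leftExp ε m i).natAbs + (rightExp ε m i).natAbs + 1),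
        coeff k (S s) •
          β (intCoeff ε (φ s) (leftExp ε m i - k)) (intCoeff ε (ψ s) (rightExp ε m i + k))
      = ∑ s, ∑ k ∈ Finset.range ((leftExp ε m i).natAbs + (rightExp ε m i).natAbs + 1),
        coeff k (S' s) •
          β' (intCoeff ε (φ' s) (leftExp ε m i - k)) (intCoeff ε (ψ' s) (rightExp ε m i + k)))
    {a : K} (ha : a ≠ 0) :
    ∑ s, (T s).eval a • ∑ p ∈ Finset.HasAntidiagonal.antidiagonal m,
        β (coeff p.1 (shift ε a (φ s))) (coeff p.2 (ψ s))
      = ∑ s, (T' s).eval a • ∑ p ∈ Finset.HasAntidiagonal.antidiagonal m,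
        β' (coeff p.1 (shift ε a (φ' s))) (coeff p.2 (ψ' s)) := by
  have h1 : ∑ s, PowerSeries.map (algebraMap K A) (S s) * (bilinPoly ε m β (φ s) (ψ s) : A⟦X⟧)
      = ∑ s, PowerSeries.map (algebraMap K A) (S' s)
        * (bilinPoly ε m β' (φ' s) (ψ' s) : A⟦X⟧) := by
    ext i
    rw [map_sum, map_sum]
    simpa only [sum_range_intCoeff] using h i
  have hmap : ∀ p : Polynomial K, PowerSeries.map (algebraMap K A) (p : K⟦X⟧)
      = ((p.map (algebraMap K A) : Polynomial A) : A⟦X⟧) := fun p => by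
    ext i
    simp
  -- Power series in `u/v` cannot be evaluated at `a`, and the denominators of the R-matrix may
  -- vanish there. Multiplying by `g` turns both sides into polynomials in each total degree.
  have h2 : ((∑ s, (T s).map (algebraMap K A) * bilinPoly ε m β (φ s) (ψ s) : Polynomial A) :
        A⟦X⟧)
      = ((∑ s, (T' s).map (algebraMap K A) * bilinPoly ε m β' (φ' s) (ψ' s) : Polynomial A) :
        A⟦X⟧) := by
    have := congrArg (fun y => PowerSeries.map (algebraMap K A) g * y) h1
    simp only [Finset.mul_sum, ← mul_assoc, ← map_mul, hT, hT', hmap, ← Polynomial.coe_mul] at this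
    rw [← Polynomial.coeToPowerSeries.ringHom_apply, ← Polynomial.coeToPowerSeries.ringHom_apply,
      map_sum, map_sum]
    exact this
  have h3 := congrArg (evalScalar A a) (Polynomial.coe_injective A h2)
  rw [map_sum, map_sum] at h3
  simp only [map_mul, evalScalar_map, evalScalar_bilinPoly _ _ _ _ _ ha, ← Algebra.smul_def,
    smul_comm _ (evalFactor ε m a), ← Finset.smul_sum] at h3
  exact smul_right_injective _ (evalFactor_ne_zero ε m ha) h3

variable {n : ℕ} {S : Matrix (Fin (2 * n) × Fin (2 * n)) (Fin (2 * n) × Fin (2 * n)) K⟦X⟧}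

theorem mkAlgHom_mode (ε : Sgn) (i j : Fin (2 * n)) (r : ℤ) :
    RingQuot.mkAlgHom K (Rel n S) (mode ε i j r) = intCoeff ε (Lop n S ε i j) r := by
  rw [mode, intCoeff]
  split_ifs
  · rw [Lop, Matrix.of_apply, coeff_mk]
  · rw [map_zero]

/-- The right-hand side has the factor in `v` first, hence the flipped multiplication. Fixing the
total degree `±m` isolates one coefficient of the specialized identity. -/
theorem rMatrixRel_Lop (g : K⟦X⟧) (hg : ∀ r s, g * S r s = rPoly n (X : K⟦X⟧) r s) (ε : Sgn) :
    RMatrixRel ε (Lop n S ε) := by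
  have hT : ∀ r s, g * S r s = ((rPoly n (Polynomial.X : Polynomial K) r s : Polynomial K) : K⟦X⟧) := fun r s => by
    rw [hg]
    have := map_rPoly (Polynomial.coeToPowerSeries.algHom K) n (Polynomial.X : Polynomial K) r s
    simp only [Polynomial.coeToPowerSeries.algHom_apply, Algebra.algebraMap_self,
      PowerSeries.map_id, Polynomial.coe_X] at this
    exact this.symm
  have heval : ∀ a r s, (rPoly n (Polynomial.X : Polynomial K) r s).eval a = rPoly n a r s :=
    fun a r s => by
      have := map_rPoly (Polynomial.aeval a) n (Polynomial.X : Polynomial K) r s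
      rwa [Polynomial.aeval_X, Polynomial.coe_aeval_eq_eval] at this
  intro a ha i j k l
  ext m
  have := eval_double_series (A := U n S) (ι := Fin (2 * n) × Fin (2 * n))
    (ι' := Fin (2 * n) × Fin (2 * n)) ε m (LinearMap.mul K _) (LinearMap.mul K _).flip
    (fun s => Lop n S ε s.1 k) (fun s => Lop n S ε s.2 l) (fun s => Lop n S ε i s.1)
    (fun s => Lop n S ε j s.2) (fun s => S (i, j) s) (fun s => S s (k, l)) _ _ g
    (fun s => hT (i, j) s) (fun s => hT s (k, l)) (fun i0 => ?_) ha
  · simp only [sum_mul_eq, sum_mul_flip_eq, heval] at this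
    rw [← Fintype.sum_prod_type' (f := fun e f => rPoly n a (i, j) (e, f) • _),
      ← Fintype.sum_prod_type' (f := fun e f => rPoly n a (e, f) (k, l) • _), map_sum, map_sum]
    simpa only [coeff_smul] using this
  · have h := RingQuot.mkAlgHom_rel K
      (Rel.rll_same (S := S) ε i j k l (leftExp ε m i0) (rightExp ε m i0))
    simp only [rllLeft, rllRight, one_pow, one_mul, mul_one, map_sum, map_smul, map_mul,
      mkAlgHom_mode] at h
    rw [Finset.sum_comm, Finset.sum_comm (s := Finset.univ)]
    simp only [Fintype.sum_prod_type]
    exact h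

end RLL

/-! ### Assembly for both algebras -/

section main

variable {n : ℕ} {S : Matrix (Fin (2 * n) × Fin (2 * n)) (Fin (2 * n) × Fin (2 * n)) K⟦X⟧}

/-- A power series is a unit as soon as its constant term is. The constant terms of `L^+` and `L^-`
are lower and upper triangular respectively, with mutually inverse diagonals. -/
theorem hasUnitPivots_Lop (ε : Sgn) : HasUnitPivots (Lop n S ε) := by
  have hcoeff : ∀ i j, constantCoeff (Lop n S ε i j)
      = RingQuot.mkAlgHom K (Rel n S) (FreeAlgebra.ι K (.l ε i j 0)) := fun i j => by
    rw [← coeff_zero_eq_constantCoeff_apply, Lop, Matrix.of_apply, coeff_mk]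
  have hpm := fun i => RingQuot.mkAlgHom_rel K (Rel.diag_plus_minus (S := S) i)
  have hmp := fun i => RingQuot.mkAlgHom_rel K (Rel.diag_minus_plus (S := S) i)
  simp only [map_mul, map_one] at hpm hmp
  refine hasUnitPivots_of_triangular constantCoeff (fun x => isUnit_iff_constantCoeff.2) _
    (fun i => ?_) ?_
  · rw [hcoeff]
    cases ε with
    | plus => exact ⟨⟨_, _, hpm i, hmp i⟩, rfl⟩
    | minus => exact ⟨⟨_, _, hmp i, hpm i⟩, rfl⟩
  · simp only [hcoeff]
    cases ε with
    | plus =>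
      left
      intro i j hij
      rw [RingQuot.mkAlgHom_rel K (Rel.plus_zero (S := S) i j hij), map_zero]
    | minus =>
      right
      intro i j hij
      rw [RingQuot.mkAlgHom_rel K (Rel.minus_zero (S := S) j i hij), map_zero]

theorem isGauss_iff {A : Type} [Ring A] [Algebra K A]
    {L : Matrix (Fin (2 * n)) (Fin (2 * n)) A⟦X⟧} {G : GaussData n A} :
    IsGauss L G ↔ IsLDU L G.F G.h G.E :=
  ⟨fun h => ⟨h.1, h.2.1, h.2.2.1, h.2.2.2.1, h.2.2.2.2⟩,
    fun h => ⟨h.F_diag, h.F_upper, h.E_diag, h.E_lower, h.eq⟩⟩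

theorem existsUnique_isGauss {A : Type} [Ring A] [Algebra K A]
    {L : Matrix (Fin (2 * n)) (Fin (2 * n)) A⟦X⟧} (hL : HasUnitPivots L) :
    ∃! G : GaussData n A, IsGauss L G := by
  obtain ⟨F, E, H⟩ := hL.exists_isLDU
  refine ⟨⟨F, pivot L, E⟩, isGauss_iff.2 H, fun G hG => ?_⟩
  obtain ⟨hF, hh, hE⟩ := (isGauss_iff.1 hG).unique H hL
  cases G
  simp only at hF hh hE
  rw [hF, hh, hE]

/-- Only a scalar multiple of `S` enters the argument, so one statement with a free factor `g`
serves `R̄` and `R`. -/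
theorem gauss_and_central (hn : 1 ≤ n) (g : K⟦X⟧)
    (hg : ∀ r s, g * S r s = rPoly n (X : K⟦X⟧) r s) (ε : Sgn) :
    (∃! G : GaussData n (U n S), IsGauss (Lop n S ε) G) ∧
      (∃! z : (U n S)⟦X⟧, IsCentralSeries ε (Lop n S ε) z) ∧
      ∀ G z, IsGauss (Lop n S ε) G → IsCentralSeries ε (Lop n S ε) z →
        (∀ i, IsUnit (G.h i)) ∧ z = centralProduct hn ε G.h := by
  have hL := hasUnitPivots_Lop (S := S) ε
  have hR := rMatrixRel_Lop g hg ε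
  refine ⟨existsUnique_isGauss hL, hR.exists_central hn, fun G z hG hz => ?_⟩
  have hu := hL.isUnit_of_isLDU (isGauss_iff.1 hG)
  exact ⟨hu, hR.central_eq hn (isGauss_iff.1 hG) hu hz⟩

theorem constantCoeff_poch_rescale (a p : K) : constantCoeff (rescale a (poch p)) = 1 := by
  rw [← coeff_zero_eq_constantCoeff_apply, coeff_rescale, poch, coeff_mk, pochCoeff, pow_zero,
    one_mul]

theorem constantCoeff_fSeries_ne_zero (n : ℕ) : constantCoeff (fSeries n) ≠ 0 := by
  simp only [fSeries, map_mul, map_pow, constantCoeff_poch_rescale, constantCoeff_inv,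
    constantCoeff_C, one_pow, mul_one, inv_one]
  exact mul_ne_zero (xi_ne_zero n) (zpow_ne_zero _ q_ne_zero)

end main

end QAff

theorem mainTheorem9 (n : ℕ) (hn : 1 ≤ n) :
    -- the algebra `U(R̄^{[n]})`, both signs
    (∀ ε : QAff.Sgn,
      (∃! G : QAff.GaussData n (QAff.U n (QAff.Rbar n)),
        QAff.IsGauss (QAff.Lop n (QAff.Rbar n) ε) G) ∧
      (∃! z : PowerSeries (QAff.U n (QAff.Rbar n)),
        QAff.IsCentralSeries ε (QAff.Lop n (QAff.Rbar n) ε) z) ∧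
      ∀ G z, QAff.IsGauss (QAff.Lop n (QAff.Rbar n) ε) G →
        QAff.IsCentralSeries ε (QAff.Lop n (QAff.Rbar n) ε) z →
        (∀ i, IsUnit (G.h i)) ∧ z = QAff.centralProduct hn ε G.h) ∧
    -- the algebra `U(R^{[n]})`, both signs
    (∀ ε : QAff.Sgn,
      (∃! G : QAff.GaussData n (QAff.U n (QAff.Rmat n)),
        QAff.IsGauss (QAff.Lop n (QAff.Rmat n) ε) G) ∧
      (∃! z : PowerSeries (QAff.U n (QAff.Rmat n)),
        QAff.IsCentralSeries ε (QAff.Lop n (QAff.Rmat n) ε) z) ∧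
      ∀ G z, QAff.IsGauss (QAff.Lop n (QAff.Rmat n) ε) G →
        QAff.IsCentralSeries ε (QAff.Lop n (QAff.Rmat n) ε) z →
        (∀ i, IsUnit (G.h i)) ∧ z = QAff.centralProduct hn ε G.h) := by
  -- For `R` the clearing factor also contains `f⁻¹`, a power series because `f` has constant term
  -- `ξ q⁻² ≠ 0`.
  refine ⟨QAff.gauss_and_central hn _ (QAff.rPoly_mul_Rbar n),
    QAff.gauss_and_central hn ((PowerSeries.X - PowerSeries.C (QAff.q ^ (-2 : ℤ)))
      * (PowerSeries.X - PowerSeries.C (QAff.xi n)) * (QAff.fSeries n)⁻¹) fun r s => ?_⟩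
  rw [← QAff.rPoly_mul_Rbar, QAff.Rmat, Matrix.smul_apply, smul_eq_mul, mul_assoc,
    ← mul_assoc (QAff.fSeries n)⁻¹,
    PowerSeries.inv_mul_cancel _ (QAff.constantCoeff_fSeries_ne_zero n), one_mul]
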